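/- Let $s\ge 3$ be an integer, $r>0$, and let $\omega(p)=|p|$ on momentum space $\mathbb R^s$. Write $\tilde g(p)=(2\pi)^{-s/2}\int e^{-ip\cdot x}g(x)\,d^sx$, let $D(O_r)$ be the space of smooth complex-valued functions with compact support in the open ball $O_r$ of radius $r$ centred at $0$ in $\mathbb R^s$, and let $\mathcal L^{\pm}$ denote the closed subspace $\overline{\{\omega^{\mp 1/2}\tilde g: g\in D(O_r)\}}$ of $L^2(\mathbb R^s,d^sp)$ as well as the orthogonal projection onto it. For $x=(x^0,\vec x)\in\mathbb R^{s+1}$ let $(U(x)f)(p)=e^{i(\omega(p)x^0-p\cdot\vec x)}f(p)$ and let $J$ be complex conjugation in configuration space, i.e. $(Jf)(p)=\overline{f(-p)}$. Fix a real-valued $h\in D(O_r)$ with $\tilde h>0$ everywhere. For $E\ge0$ and $\tfrac12\le\gamma<\tfrac{s-1}2$ let $Q_E$ be the multiplication by the indicator function of $\{|p|\le E\}$ and let $T$ be the positive operator $$T=\big(|T_{E,+}|^2+|T_{E,-}|^2+|T_{h,+}|^2+|T_{h,-}|^2\big)^{1/2},\qquad T_{E,\pm}=\omega^{-1/2}Q_E\mathcal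 L^{\pm},\quad T_{h,\pm}=\omega^{-\gamma}\tilde h^{1/2}\mathcal L^{\pm},$$ where $|A|^2=A^*A$. Then for every $\varepsilon>0$ there is a constant $c$, depending only on $s,r,h,\varepsilon$, such that for all $E\ge 0$, all $\gamma\in[\tfrac12,\tfrac{s-1}2)$, all $e\in L^2(\mathbb R^s,d^sp)$ with $\|e\|\le1$, $Je=e$ and $Te=te$ for some $t\in\mathbb R$, and all $x=(x^0,\vec x)\in\mathbb R^{s+1}$ with $|\vec x|\ge|x^0|$, for both signs, $$\big|\langle\tilde h\,\omega^{-1/2}\mathcal L^{\pm}e,\;U(x)\,\tilde h\,\omega^{-1/2}\mathcal L^{\pm}e\rangle\big|\le\frac{c\,t^2}{(|\vec x|-|x^0|+1)^{\,s-2-\varepsilon}}.$$ -/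

import Mathlib

open MeasureTheory Metric Filter Topology
open scoped ContDiff ENNReal ComplexConjugate

noncomputable section

namespace MasslessField

/-- Configuration (or momentum) space `ℝˢ` with its Euclidean norm. -/
abbrev Space (s : ℕ) : Type := EuclideanSpace ℝ (Fin s)

/-- The single-particle space `L²(ℝˢ, dˢp)` (momentum representation). -/
abbrev OneParticle (s : ℕ) : Type := Lp ℂ 2 (volume : Measure (Space s))

variable {s : ℕ}

/-- The unitary Fourier transform `g̃(p) = (2π)^(-s/2) ∫ e^{-i p·x} g(x) dˢx`. -/
def ft (g : Space s → ℂ) (p : Space s) : ℂ :=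
  (((2 * Real.pi) ^ (-(s : ℝ) / 2) : ℝ) : ℂ) *
    ∫ x, Complex.exp (-Complex.I * ((inner ℝ p x : ℝ) : ℂ)) * g x

/-- `g ∈ D(O_r)`: complex-valued smooth functions with (compact) support in the open ball of
radius `r` centered at the origin. -/
def IsTest (r : ℝ) (g : Space s → ℂ) : Prop :=
  ContDiff ℝ ∞ g ∧ tsupport g ⊆ ball 0 r

theorem IsTest.hasCompactSupport {r : ℝ} {g : Space s → ℂ} (hg : IsTest r g) :
    HasCompactSupport g :=
  HasCompactSupport.of_support_subset_isCompact (isCompact_closedBall (0 : Space s) r)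
    ((subset_tsupport g).trans (hg.2.trans ball_subset_closedBall))

theorem IsTest.integrable {r : ℝ} {g : Space s → ℂ} (hg : IsTest r g) : Integrable g :=
  hg.1.continuous.integrable_of_hasCompactSupport hg.hasCompactSupport

theorem integrable_phase {g : Space s → ℂ} (hg : Integrable g) (p : Space s) :
    Integrable (fun x => Complex.exp (-Complex.I * ((inner ℝ p x : ℝ) : ℂ)) * g x) := by
  refine hg.bdd_mul (c := 1) (Continuous.aestronglyMeasurable (by fun_prop)) ?_
  filter_upwards with x
  rw [Complex.norm_exp]
  simp

theorem ft_add {f g : Space s → ℂ} (hf : Integrable f) (hg : Integrable g) (p : Space s) :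
    ft (f + g) p = ft f p + ft g p := by
  unfold ft
  rw [← mul_add, ← integral_add (integrable_phase hf p) (integrable_phase hg p)]
  simp [mul_add]

theorem ft_smul (c : ℂ) (f : Space s → ℂ) (p : Space s) : ft (c • f) p = c * ft f p := by
  unfold ft
  have : ∀ x, Complex.exp (-Complex.I * ((inner ℝ p x : ℝ) : ℂ)) * (c • f) x =
      c * (Complex.exp (-Complex.I * ((inner ℝ p x : ℝ) : ℂ)) * f x) := fun x => by
    rw [Pi.smul_apply, smul_eq_mul, mul_left_comm]
  simp_rw [this, integral_const_mul]
  ring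

/-- The linear space of all elements `ω^a g̃` of `L²(ℝˢ)` with `g ∈ D(O_r)`, `ω(p) = |p|`. -/
def localCore (r a : ℝ) : Submodule ℂ (OneParticle s) where
  carrier := {φ | ∃ g : Space s → ℂ, IsTest r g ∧
    (φ : Space s → ℂ) =ᵐ[volume] fun p => ((‖p‖ ^ a : ℝ) : ℂ) * ft g p}
  add_mem' := by
    rintro φ ψ ⟨f, hf, hφ⟩ ⟨g, hg, hψ⟩
    refine ⟨f + g, ⟨hf.1.add hg.1,
      (tsupport_add f g).trans (Set.union_subset hf.2 hg.2)⟩, ?_⟩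
    filter_upwards [hφ, hψ, Lp.coeFn_add φ ψ] with p h1 h2 h3
    rw [h3, Pi.add_apply, h1, h2, ft_add hf.integrable hg.integrable, mul_add]
  zero_mem' := by
    refine ⟨0, ⟨contDiff_const, by simp [tsupport]⟩, ?_⟩
    filter_upwards [Lp.coeFn_zero ℂ 2 (volume : Measure (Space s))] with p h
    rw [h]
    simp [ft]
  smul_mem' := by
    rintro c φ ⟨f, hf, hφ⟩
    refine ⟨c • f, ⟨contDiff_const.smul hf.1,
      (closure_mono (Function.support_const_smul_subset c f)).trans hf.2⟩, ?_⟩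
    filter_upwards [hφ, Lp.coeFn_smul c φ] with p h1 h2
    rw [h2, Pi.smul_apply, h1, ft_smul, smul_eq_mul]
    ring

/-- The closed subspace `[ω^a D̃(O_r)]` of `L²(ℝˢ)`. -/
def localSubspace (s : ℕ) (r a : ℝ) : Submodule ℂ (OneParticle s) :=
  (localCore r a).topologicalClosure

instance (r a : ℝ) : CompleteSpace (localSubspace s r a) :=
  inferInstanceAs (CompleteSpace (localCore r a).topologicalClosure)

/-- `𝓛⁺ = [ω^{-1/2} D̃(O_r)]`. -/
abbrev LPlus (s : ℕ) (r : ℝ) : Submodule ℂ (OneParticle s) := localSubspace s r (-(1 / 2))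

/-- `𝓛⁻ = [ω^{1/2} D̃(O_r)]`. -/
abbrev LMinus (s : ℕ) (r : ℝ) : Submodule ℂ (OneParticle s) := localSubspace s r (1 / 2)

open Classical in
/-- The operator `m K` : orthogonal projection onto the closed subspace `K`, followed by
multiplication by the function `m`. It is the bounded operator `A` with `(A f)(p) = m(p) (K f)(p)`
(and `0` if there is no such bounded operator; `opE_apply`, `opH_apply`, `opV_apply` below show
that all the operators used here exist). -/
def mulProj (K : Submodule ℂ (OneParticle s)) [K.HasOrthogonalProjection] (m : Space s → ℝ) :
    OneParticle s →L[ℂ] OneParticle s :=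
  if h : ∃ A : OneParticle s →L[ℂ] OneParticle s, ∀ f : OneParticle s,
      (A f : Space s → ℂ) =ᵐ[volume] fun p => (m p : ℂ) * (K.starProjection f : Space s → ℂ) p
  then h.choose else 0

/-- `h̃` as a real function, for `h` whose Fourier transform is real. -/
def ftRe (h : Space s → ℝ) (p : Space s) : ℝ := (ft (fun x => (h x : ℂ)) p).re

/-- `T_{E,±} = ω^{-1/2} Q_E 𝓛^±`, where `Q_E` projects onto energies `|p| ≤ E`. -/
def opE (E : ℝ) (K : Submodule ℂ (OneParticle s)) [K.HasOrthogonalProjection] :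
    OneParticle s →L[ℂ] OneParticle s :=
  mulProj K fun p => ‖p‖ ^ (-(1 / 2) : ℝ) * Set.indicator (closedBall 0 E) (fun _ => (1 : ℝ)) p

/-- `T_{h,±} = ω^{-γ} h̃^{1/2} 𝓛^±`. -/
def opH (h : Space s → ℝ) (γ : ℝ) (K : Submodule ℂ (OneParticle s)) [K.HasOrthogonalProjection] :
    OneParticle s →L[ℂ] OneParticle s :=
  mulProj K fun p => ‖p‖ ^ (-γ) * ftRe h p ^ (1 / 2 : ℝ)

/-- `|A|² = A* A`. -/
def absSq (A : OneParticle s →L[ℂ] OneParticle s) : OneParticle s →L[ℂ] OneParticle s :=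
  star A * A

/-- The positive square root of a positive operator on a Hilbert space. -/
def posSqrt {H : Type*} [NormedAddCommGroup H] [InnerProductSpace ℂ H] [CompleteSpace H]
    (A : H →L[ℂ] H) : H →L[ℂ] H :=
  CFC.sqrt A

/-- `T = (|T_{E,+}|² + |T_{E,-}|² + |T_{h,+}|² + |T_{h,-}|²)^{1/2}` (positive square root). -/
def opT (s : ℕ) (r : ℝ) (h : Space s → ℝ) (E γ : ℝ) : OneParticle s →L[ℂ] OneParticle s :=
  posSqrt (absSq (opE E (LPlus s r)) + absSq (opE E (LMinus s r)) +
    absSq (opH h γ (LPlus s r)) + absSq (opH h γ (LMinus s r)))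

/-- `h̃ ω^{-1/2} 𝓛^±`. -/
def opV (h : Space s → ℝ) (K : Submodule ℂ (OneParticle s)) [K.HasOrthogonalProjection] :
    OneParticle s →L[ℂ] OneParticle s :=
  mulProj K fun p => ‖p‖ ^ (-(1 / 2) : ℝ) * ftRe h p

/-- Complex conjugation in configuration space; in momentum space `(J f)(p) = conj (f(-p))`
(see `ft_conj`). -/
def opJ (f : OneParticle s) : OneParticle s :=
  star (Lp.compMeasurePreserving (fun p : Space s => -p) (Measure.measurePreserving_neg volume) f)

theorem opJ_apply (f : OneParticle s) :
    (opJ f : Space s → ℂ) =ᵐ[volume] fun p => conj ((f : Space s → ℂ) (-p)) := by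
  filter_upwards [Lp.coeFn_star (Lp.compMeasurePreserving (fun p : Space s => -p)
    (Measure.measurePreserving_neg volume) f),
    Lp.coeFn_compMeasurePreserving f (Measure.measurePreserving_neg (volume : Measure (Space s)))]
    with p h1 h2
  rw [opJ, h1, Pi.star_apply, h2]
  rfl

theorem ft_conj (g : Space s → ℂ) (p : Space s) :
    ft (fun x => conj (g x)) p = conj (ft g (-p)) := by
  unfold ft
  rw [map_mul, Complex.conj_ofReal, ← integral_conj]
  congr 2
  ext x
  rw [map_mul, ← Complex.exp_conj]
  simp

/-- The phase `e^{i(ω(p) x⁰ - p·x)}`. -/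
def phase (x₀ : ℝ) (x p : Space s) : ℂ :=
  Complex.exp (Complex.I * ((‖p‖ * x₀ - inner ℝ p x : ℝ) : ℂ))

theorem norm_phase (x₀ : ℝ) (x p : Space s) : ‖phase x₀ x p‖ = 1 := by
  rw [phase, mul_comm, Complex.norm_exp_ofReal_mul_I]

theorem continuous_phase (x₀ : ℝ) (x : Space s) : Continuous (phase x₀ x) := by
  unfold phase
  fun_prop

theorem memLp_phase (x₀ : ℝ) (x : Space s) (f : OneParticle s) :
    MemLp (fun p => phase x₀ x p * (f : Space s → ℂ) p) 2 volume := by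
  refine (Lp.memLp f).of_le
    ((continuous_phase x₀ x).aestronglyMeasurable.mul (Lp.aestronglyMeasurable f)) ?_
  filter_upwards with p
  rw [norm_mul, norm_phase, one_mul]

/-- The unitary translations `(U(x) f)(p) = e^{i(ω(p) x⁰ - p·x)} f(p)` on the single-particle
space, `x = (x⁰, x)`. -/
def transl (x₀ : ℝ) (x : Space s) : OneParticle s →ₗᵢ[ℂ] OneParticle s where
  toFun f := (memLp_phase x₀ x f).toLp _
  map_add' f g := by
    apply Lp.ext
    filter_upwards [(memLp_phase x₀ x f).coeFn_toLp, (memLp_phase x₀ x g).coeFn_toLp,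
      (memLp_phase x₀ x (f + g)).coeFn_toLp, Lp.coeFn_add f g,
      Lp.coeFn_add ((memLp_phase x₀ x f).toLp _) ((memLp_phase x₀ x g).toLp _)]
      with p h1 h2 h3 h4 h5
    rw [h3, h5, Pi.add_apply, h1, h2, h4, Pi.add_apply, mul_add]
  map_smul' c f := by
    apply Lp.ext
    filter_upwards [(memLp_phase x₀ x f).coeFn_toLp,
      (memLp_phase x₀ x (c • f)).coeFn_toLp, Lp.coeFn_smul c f,
      Lp.coeFn_smul c ((memLp_phase x₀ x f).toLp _)] with p h1 h2 h3 h4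
    rw [RingHom.id_apply, h2, h4, Pi.smul_apply, h1, h3, Pi.smul_apply, smul_eq_mul, smul_eq_mul]
    ring
  norm_map' f := by
    change ‖(memLp_phase x₀ x f).toLp _‖ = ‖f‖
    refine le_antisymm (Lp.norm_le_norm_of_ae_le ?_) (Lp.norm_le_norm_of_ae_le ?_)
    all_goals
      filter_upwards [(memLp_phase x₀ x f).coeFn_toLp] with p h1
      rw [h1, norm_mul, norm_phase, one_mul]

end MasslessField

/-! The rest of this file proves that the operators `opE`, `opH`, `opV` are well defined, i.e. that
they are given by their multiplication formulas. -/

namespace MasslessField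
variable {s : ℕ}
open scoped FourierTransform SchwartzMap

theorem ft_eq_fourier (g : Space s → ℂ) (p : Space s) :
    ft g p = (((2 * Real.pi) ^ (-(s : ℝ) / 2) : ℝ) : ℂ) * 𝓕 g ((2 * Real.pi)⁻¹ • p) := by
  rw [ft, Real.fourier_eq']
  congr 2
  ext x
  rw [smul_eq_mul, inner_smul_right, real_inner_comm p x]
  congr 2
  have : (Real.pi : ℂ) ≠ 0 := by exact_mod_cast Real.pi_ne_zero
  push_cast
  field_simp

/-- Reproducing inequality for Fourier transforms of functions supported in a fixed ball. -/
theorem exists_kernel (s : ℕ) (r : ℝ) : ∃ K : Space s → ℝ, Continuous K ∧ (∀ u, 0 ≤ K u) ∧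
    (∃ B, ∀ u, K u ≤ B) ∧ Integrable (fun u => K u ^ 2 * (2 + ‖u‖)) ∧
    ∀ g : Space s → ℂ, IsTest r g → ∀ p, ‖ft g p‖ ≤ ∫ q, K (q - p) * ‖ft g q‖ := by
  let b : ContDiffBump (0 : Space s) :=
    ⟨max r 1, max r 1 + 1, lt_of_lt_of_le one_pos (le_max_right _ _), by linarith⟩
  have hbc : HasCompactSupport (fun x => ((b x : ℝ) : ℂ)) :=
    b.hasCompactSupport.comp_left Complex.ofReal_zero
  have hbs : ContDiff ℝ ∞ (fun x => ((b x : ℝ) : ℂ)) :=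
    Complex.ofRealCLM.contDiff.comp b.contDiff
  let χ : 𝓢(Space s, ℂ) := hbc.toSchwartzMap hbs
  have hrep : ∀ g : Space s → ℂ, IsTest r g → ∀ ξ,
      ‖𝓕 g ξ‖ ≤ ∫ η, ‖𝓕 χ (η - ξ)‖ * ‖𝓕 g η‖ := by
    intro g hg ξ
    have hkc : HasCompactSupport
        (fun x : Space s => Complex.exp (((2 * Real.pi * inner ℝ x ξ : ℝ) : ℂ) * Complex.I) *
          ((b x : ℝ) : ℂ)) := hbc.mul_left
    have hks : ContDiff ℝ ∞
        (fun x : Space s => Complex.exp (((2 * Real.pi * inner ℝ x ξ : ℝ) : ℂ) * Complex.I) *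
          ((b x : ℝ) : ℂ)) := by
      refine ContDiff.mul (ContDiff.cexp (ContDiff.mul ?_ contDiff_const)) hbs
      refine Complex.ofRealCLM.contDiff.comp (contDiff_const.mul ?_)
      exact contDiff_id.inner ℝ contDiff_const
    let k : 𝓢(Space s, ℂ) := hkc.toSchwartzMap hks
    let G : 𝓢(Space s, ℂ) := hg.hasCompactSupport.toSchwartzMap hg.1
    have hk : ∀ η, 𝓕 k η = 𝓕 χ (η - ξ) := by
      intro η
      rw [SchwartzMap.fourier_coe, SchwartzMap.fourier_coe, Real.fourier_eq', Real.fourier_eq']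
      congr 1
      ext x
      simp only [smul_eq_mul, k, χ, HasCompactSupport.toSchwartzMap_toFun, ← mul_assoc,
        ← Complex.exp_add, inner_sub_right]
      congr 2
      push_cast
      ring
    have hG : 𝓕 g ξ = ∫ x, inner ℂ (k x) (G x) := by
      rw [Real.fourier_eq']
      congr 1
      ext x
      rw [RCLike.inner_apply, smul_eq_mul]
      simp only [k, G, HasCompactSupport.toSchwartzMap_toFun]
      by_cases hx : x ∈ ball (0 : Space s) r
      · have : b x = 1 := b.one_of_mem_closedBall
          (ball_subset_closedBall (ball_subset_ball (le_max_left _ _) hx))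
        rw [this, map_mul, ← Complex.exp_conj]
        have h2 : conj (2 : ℂ) = 2 := map_ofNat _ 2
        simp [mul_comm, h2]
      · have : g x = 0 := image_eq_zero_of_notMem_tsupport (fun h => hx (hg.2 h))
        simp [this]
    rw [hG, ← SchwartzMap.integral_inner_fourier_fourier]
    refine (norm_integral_le_integral_norm _).trans (integral_mono_of_nonneg
      (Filter.Eventually.of_forall fun _ => norm_nonneg _) ?_
      (Filter.Eventually.of_forall fun η => ?_))
    · have h1 : Integrable (fun η => ‖𝓕 g η‖) := by
        have := (𝓕 G).integrable (μ := volume)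
        rw [SchwartzMap.fourier_coe] at this
        exact this.norm
      obtain ⟨C, -, hC⟩ := (𝓕 χ).decay 0 0
      refine h1.bdd_mul (c := C) ?_ (Filter.Eventually.of_forall fun η => ?_)
      · exact (((𝓕 χ).continuous.comp (continuous_id.sub continuous_const)).norm).aestronglyMeasurable
      · simpa using hC (η - ξ)
    · have : 𝓕 g η = 𝓕 G η := by rw [SchwartzMap.fourier_coe]; rfl
      simp only [this, ← hk]
      exact norm_inner_le_norm _ _
  set a : ℝ := (2 * Real.pi)⁻¹ with ha
  have ha0 : 0 < a := by positivity
  obtain ⟨C, -, hC⟩ := (𝓕 χ).decay 0 0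
  refine ⟨fun u => a ^ s * ‖𝓕 χ (a • u)‖, ?_, ?_, ⟨a ^ s * C, ?_⟩, ?_, ?_⟩
  · exact continuous_const.mul ((𝓕 χ).continuous.comp (continuous_const_smul a)).norm
  · intro u; positivity
  · intro u
    have := hC (a • u)
    simp only [pow_zero, one_mul, norm_iteratedFDeriv_zero] at this
    exact mul_le_mul_of_nonneg_left this (by positivity)
  · have h0 : Integrable (fun v : Space s => ‖𝓕 χ v‖ * (2 + a⁻¹ * ‖v‖)) := by
      have h1 := ((𝓕 χ).integrable (μ := volume)).norm.const_mul 2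
      have h2 := ((𝓕 χ).integrable_pow_mul volume 1).const_mul a⁻¹
      refine (h1.add h2).congr (Filter.Eventually.of_forall fun v => ?_)
      simp only [Pi.add_apply, pow_one]
      ring
    have h3 : Integrable (fun v : Space s => ‖𝓕 χ v‖ ^ 2 * (2 + a⁻¹ * ‖v‖)) := by
      refine (h0.bdd_mul (c := C) (f := fun v => ‖𝓕 χ v‖)
        (𝓕 χ).continuous.norm.aestronglyMeasurable
        (Filter.Eventually.of_forall fun v => by simpa using hC v)).congr
        (Filter.Eventually.of_forall fun v => ?_)
      simp only
      ring
    have h4 := (h3.comp_smul (R := a) ha0.ne').const_mul ((a ^ s) ^ 2)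
    refine h4.congr (Filter.Eventually.of_forall fun v => ?_)
    simp only [norm_smul, Real.norm_of_nonneg ha0.le]
    field_simp
  · intro g hg p
    simp only [ft_eq_fourier, norm_mul, ← ha]
    have h5 : ∫ q : Space s, a ^ s * ‖𝓕 χ (a • (q - p))‖ *
        (‖(((2 * Real.pi) ^ (-(s : ℝ) / 2) : ℝ) : ℂ)‖ * ‖𝓕 g (a • q)‖) =
        ‖(((2 * Real.pi) ^ (-(s : ℝ) / 2) : ℝ) : ℂ)‖ *
          ∫ η, ‖𝓕 χ (η - a • p)‖ * ‖𝓕 g η‖ := by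
      have h6 := Measure.integral_comp_smul (volume : Measure (Space s))
        (fun η => ‖𝓕 χ (η - a • p)‖ * ‖𝓕 g η‖) a
      have h7 : ∫ η, ‖𝓕 χ (η - a • p)‖ * ‖𝓕 g η‖ =
          a ^ s * ∫ q : Space s, ‖𝓕 χ (a • q - a • p)‖ * ‖𝓕 g (a • q)‖ := by
        rw [h6, finrank_euclideanSpace_fin, smul_eq_mul, abs_of_pos (by positivity), ← mul_assoc,
          mul_inv_cancel₀ (by positivity), one_mul]
      rw [h7, ← mul_assoc, ← integral_const_mul]
      congr 1
      ext q
      rw [smul_sub]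
      ring
    rw [h5]
    gcongr
    exact hrep g hg _

end MasslessField

namespace MasslessField
variable {s : ℕ}

/-- Square integrability of the kernel against the weight, uniformly for small momenta. -/
theorem kernel_weight_bound (hs : 2 ≤ s) {a : ℝ} (ha : |a| ≤ 1 / 2) {K : Space s → ℝ}
    (hKc : Continuous K) (hK0 : ∀ u, 0 ≤ K u) {B : ℝ} (hB : ∀ u, K u ≤ B)
    (hKi : Integrable (fun u => K u ^ 2 * (2 + ‖u‖))) :
    ∃ M : ℝ, ∀ p : Space s, ‖p‖ < 1 →
      Integrable (fun q => (K (q - p) * ‖q‖ ^ (-a)) ^ 2) ∧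
      ∫ q, (K (q - p) * ‖q‖ ^ (-a)) ^ 2 ≤ M := by
  obtain ⟨ha1, ha2⟩ := abs_le.1 ha
  have hI : IntegrableOn (fun q : Space s => B ^ 2 * ‖q‖ ^ (-1 : ℝ)) (ball 0 1) := by
    refine integrableOn_ball_of_norm_le_rpow (C := B ^ 2) (α := 1)
      (by rw [finrank_euclideanSpace_fin]; omega)
      (by rw [finrank_euclideanSpace_fin]; exact_mod_cast (by omega : 1 < s)) ?_ ?_
    · filter_upwards with q
      rw [Real.norm_of_nonneg (by positivity)]
    · exact (measurable_const.mul (measurable_norm.pow_const _)).aestronglyMeasurable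
  rw [← integrable_indicator_iff measurableSet_ball] at hI
  have hJ : ∀ p : Space s, Integrable (fun q => K (q - p) ^ 2 * (2 + ‖q - p‖)) :=
    fun p => hKi.comp_sub_right p
  have hle : ∀ p : Space s, ‖p‖ < 1 → ∀ q, (K (q - p) * ‖q‖ ^ (-a)) ^ 2 ≤
      (ball (0 : Space s) 1).indicator (fun q => B ^ 2 * ‖q‖ ^ (-1 : ℝ)) q +
        K (q - p) ^ 2 * (2 + ‖q - p‖) := by
    intro p hp q
    have hsq : (‖q‖ ^ (-a)) ^ 2 = ‖q‖ ^ (-(2 * a)) := by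
      rw [← Real.rpow_natCast, ← Real.rpow_mul (norm_nonneg _)]
      congr 1
      push_cast
      ring
    have hK2 : K (q - p) ^ 2 ≤ B ^ 2 := by
      have := hK0 (q - p); have := hB (q - p); gcongr
    have hind : 0 ≤ (ball (0 : Space s) 1).indicator (fun q => B ^ 2 * ‖q‖ ^ (-1 : ℝ)) q :=
      Set.indicator_nonneg (fun q _ => by positivity) q
    rw [mul_pow, hsq]
    rcases eq_or_ne q 0 with rfl | hq0
    · have h1 : ‖(0 : Space s)‖ ^ (-(2 * a)) ≤ 1 := by
        rw [norm_zero]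
        exact Real.zero_rpow_le_one _
      have h2 : K (0 - p) ^ 2 * ‖(0 : Space s)‖ ^ (-(2 * a)) ≤
          K (0 - p) ^ 2 * (2 + ‖0 - p‖) := by
        refine mul_le_mul_of_nonneg_left ?_ (sq_nonneg _)
        have := norm_nonneg (0 - p)
        linarith
      linarith
    · have hqpos : 0 < ‖q‖ := norm_pos_iff.2 hq0
      by_cases hq : q ∈ ball (0 : Space s) 1
      · rw [Set.indicator_of_mem hq]
        have hq1 : ‖q‖ < 1 := by simpa using hq
        have h1 : ‖q‖ ^ (-(2 * a)) ≤ ‖q‖ ^ (-1 : ℝ) :=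
          Real.rpow_le_rpow_of_exponent_ge hqpos hq1.le (by linarith)
        have h2 : K (q - p) ^ 2 * ‖q‖ ^ (-(2 * a)) ≤ B ^ 2 * ‖q‖ ^ (-1 : ℝ) := by gcongr
        have h3 : 0 ≤ K (q - p) ^ 2 * (2 + ‖q - p‖) := by positivity
        linarith
      · have hq1 : 1 ≤ ‖q‖ := by simpa using hq
        have h1 : ‖q‖ ^ (-(2 * a)) ≤ ‖q‖ ^ (1 : ℝ) :=
          Real.rpow_le_rpow_of_exponent_le hq1 (by linarith)
        rw [Real.rpow_one] at h1
        have h2 : ‖q‖ ≤ ‖q - p‖ + ‖p‖ := by simpa using norm_add_le (q - p) p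
        have h3 : K (q - p) ^ 2 * ‖q‖ ^ (-(2 * a)) ≤ K (q - p) ^ 2 * (2 + ‖q - p‖) := by
          gcongr
          linarith
        linarith
  refine ⟨(∫ q, (ball (0 : Space s) 1).indicator (fun q => B ^ 2 * ‖q‖ ^ (-1 : ℝ)) q) +
    ∫ q : Space s, K q ^ 2 * (2 + ‖q‖), fun p hp => ?_⟩
  have hint : Integrable (fun q => (K (q - p) * ‖q‖ ^ (-a)) ^ 2) := by
    refine (hI.add (hJ p)).mono' ?_ (Filter.Eventually.of_forall fun q => ?_)
    · exact ((((hKc.comp (continuous_id.sub continuous_const)).measurable).mul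
        (measurable_norm.pow_const _)).pow_const 2).aestronglyMeasurable
    · rw [Real.norm_of_nonneg (sq_nonneg _)]
      exact hle p hp q
  refine ⟨hint, ?_⟩
  rw [← integral_sub_right_eq_self (fun q : Space s => K q ^ 2 * (2 + ‖q‖)) p,
    ← integral_add hI (hJ p)]
  exact integral_mono hint (hI.add (hJ p)) (hle p hp)

/-- Elements of `[ω^a D̃(O_r)]` are bounded by `|p|^a` for small momenta. -/
theorem localSubspace_bound (hs : 2 ≤ s) (r : ℝ) {a : ℝ} (ha : |a| ≤ 1 / 2) :
    ∃ C : ℝ, 0 ≤ C ∧ ∀ f ∈ localSubspace s r a, ∀ᵐ p : Space s, ‖p‖ < 1 →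
      ‖(f : Space s → ℂ) p‖ ≤ C * ‖f‖ * ‖p‖ ^ a := by
  obtain ⟨K, hKc, hK0, ⟨B, hB⟩, hKi, hK⟩ := exists_kernel s r
  obtain ⟨M, hM⟩ := kernel_weight_bound hs ha hKc hK0 hB hKi
  have : NeZero s := ⟨by omega⟩
  have hne : ∀ᵐ p : Space s, p ≠ 0 := by
    have : Nontrivial (Space s) := Module.nontrivial_of_finrank_pos (R := ℝ)
      (by rw [finrank_euclideanSpace_fin]; omega)
    simp [ae_iff]
  have hcore : ∀ f ∈ localCore (s := s) r a, ∀ᵐ p : Space s, ‖p‖ < 1 →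
      ‖(f : Space s → ℂ) p‖ ≤ M ^ (1 / 2 : ℝ) * ‖f‖ * ‖p‖ ^ a := by
    rintro f ⟨g, hg, hf⟩
    have hfn : ‖f‖ = (∫ q, ‖(f : Space s → ℂ) q‖ ^ (2 : ℝ)) ^ (1 / 2 : ℝ) := by
      rw [Lp.norm_def, (Lp.memLp f).eLpNorm_eq_integral_rpow_norm (by simp) (by simp),
        ENNReal.toReal_ofReal (by positivity)]
      simp
    filter_upwards [hf] with p hp hp1
    obtain ⟨hW, hWM⟩ := hM p hp1
    have hWm : MemLp (fun q => K (q - p) * ‖q‖ ^ (-a)) (ENNReal.ofReal 2) := by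
      rw [ENNReal.ofReal_ofNat, memLp_two_iff_integrable_sq]
      · exact hW
      · exact (((hKc.comp (continuous_id.sub continuous_const)).measurable).mul
          (measurable_norm.pow_const _)).aestronglyMeasurable
    have h1 : ‖ft g p‖ ≤ M ^ (1 / 2 : ℝ) * ‖f‖ := calc
      ‖ft g p‖ ≤ ∫ q, K (q - p) * ‖ft g q‖ := hK g hg p
      _ = ∫ q, (K (q - p) * ‖q‖ ^ (-a)) * ‖(f : Space s → ℂ) q‖ := by
        refine integral_congr_ae ?_
        filter_upwards [hf, hne] with q hq hq0
        have : 0 < ‖q‖ := norm_pos_iff.2 hq0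
        rw [hq, norm_mul, Complex.norm_real, Real.norm_of_nonneg (by positivity), mul_assoc,
          ← mul_assoc (‖q‖ ^ (-a)), ← Real.rpow_add this, neg_add_cancel, Real.rpow_zero, one_mul]
      _ ≤ (∫ q, (K (q - p) * ‖q‖ ^ (-a)) ^ (2 : ℝ)) ^ (1 / 2 : ℝ) *
          (∫ q, ‖(f : Space s → ℂ) q‖ ^ (2 : ℝ)) ^ (1 / 2 : ℝ) := by
        refine integral_mul_le_Lp_mul_Lq_of_nonneg Real.HolderConjugate.two_two ?_ ?_ hWm ?_
        · exact Filter.Eventually.of_forall fun q => mul_nonneg (hK0 _) (by positivity)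
        · exact Filter.Eventually.of_forall fun q => norm_nonneg _
        · rw [ENNReal.ofReal_ofNat]
          exact (Lp.memLp f).norm
      _ ≤ M ^ (1 / 2 : ℝ) * ‖f‖ := by
        rw [← hfn]
        refine mul_le_mul_of_nonneg_right ?_ (norm_nonneg _)
        refine Real.rpow_le_rpow (integral_nonneg fun q => ?_) ?_ (by norm_num)
        · simp only [Real.rpow_two]
          exact sq_nonneg _
        · simpa only [Real.rpow_two] using hWM
    rw [hp, norm_mul, Complex.norm_real, Real.norm_of_nonneg (by positivity), mul_comm]
    gcongr
  have hM0 : 0 ≤ M := by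
    obtain ⟨-, h⟩ := hM 0 (by simp)
    exact (integral_nonneg fun q => sq_nonneg _).trans h
  refine ⟨M ^ (1 / 2 : ℝ), by positivity, fun f hf => ?_⟩
  obtain ⟨u, hu, hlim⟩ := mem_closure_iff_seq_limit.1
    (show f ∈ closure (localCore (s := s) r a : Set (OneParticle s)) from hf)
  obtain ⟨n, hn, hae⟩ := (tendstoInMeasure_of_tendsto_Lp hlim).exists_seq_tendsto_ae
  have hall : ∀ᵐ p : Space s, ∀ i, ‖p‖ < 1 →
      ‖(u i : Space s → ℂ) p‖ ≤ M ^ (1 / 2 : ℝ) * ‖u i‖ * ‖p‖ ^ a :=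
    ae_all_iff.2 fun i => hcore _ (hu i)
  filter_upwards [hae, hall] with p h1 h2 hp
  refine le_of_tendsto_of_tendsto' h1.norm
    (((tendsto_const_nhds (x := M ^ (1 / 2 : ℝ))).mul
      ((hlim.comp hn.tendsto_atTop).norm)).mul_const (‖p‖ ^ a)) fun i => ?_
  exact h2 _ hp

theorem mulProj_apply_of_exists (K : Submodule ℂ (OneParticle s)) [K.HasOrthogonalProjection]
    (m : Space s → ℝ) (h : ∃ A : OneParticle s →L[ℂ] OneParticle s, ∀ f : OneParticle s,
      (A f : Space s → ℂ) =ᵐ[volume] fun p => (m p : ℂ) * (K.starProjection f : Space s → ℂ) p)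
    (f : OneParticle s) : (mulProj K m f : Space s → ℂ) =ᵐ[volume]
      fun p => (m p : ℂ) * (K.starProjection f : Space s → ℂ) p := by
  rw [mulProj, dif_pos h]
  exact h.choose_spec f

/-- The operators `ω^{-γ} β 𝓛^±` with bounded `β` exist as bounded operators. -/
theorem mulProj_apply (hs : 3 ≤ s) (r : ℝ) {a : ℝ} (ha : |a| ≤ 1 / 2) {γ : ℝ} (hγ0 : 0 ≤ γ)
    (hγ : γ < ((s : ℝ) - 1) / 2) {β : Space s → ℝ} (hβ : Measurable β) {C' : ℝ}
    (hC' : ∀ p, |β p| ≤ C') (f : OneParticle s) :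
    (mulProj (localSubspace s r a) (fun p => ‖p‖ ^ (-γ) * β p) f : Space s → ℂ) =ᵐ[volume]
      fun p => ((‖p‖ ^ (-γ) * β p : ℝ) : ℂ) *
        ((localSubspace s r a).starProjection f : Space s → ℂ) p := by
  refine mulProj_apply_of_exists _ _ ?_ f
  obtain ⟨ha1, ha2⟩ := abs_le.1 ha
  obtain ⟨C, hC0, hC⟩ := localSubspace_bound (by omega : 2 ≤ s) r ha
  have hC'0 : 0 ≤ C' := (abs_nonneg _).trans (hC' 0)
  have hΦ : MemLp ((ball (0 : Space s) 1).indicator fun p => ‖p‖ ^ (a - γ)) 2 volume := by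
    have hmeas : Measurable fun p : Space s => ‖p‖ ^ (a - γ) := measurable_norm.pow_const _
    rw [memLp_indicator_iff_restrict measurableSet_ball,
      memLp_two_iff_integrable_sq hmeas.aestronglyMeasurable]
    refine integrableOn_ball_of_norm_le_rpow (C := 1) (α := 2 * (γ - a))
      (by rw [finrank_euclideanSpace_fin]; omega)
      (by rw [finrank_euclideanSpace_fin]; linarith) ?_ (hmeas.pow_const 2).aestronglyMeasurable
    filter_upwards with p
    rw [Real.norm_of_nonneg (sq_nonneg _), one_mul, ← Real.rpow_natCast,
      ← Real.rpow_mul (norm_nonneg _)]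
    refine le_of_eq (congrArg _ ?_)
    push_cast
    ring
  have hm : Measurable fun p : Space s => ((‖p‖ ^ (-γ) * β p : ℝ) : ℂ) :=
    Complex.measurable_ofReal.comp ((measurable_norm.pow_const _).mul hβ)
  have hne : ∀ᵐ p : Space s, p ≠ 0 := by
    have : Nontrivial (Space s) := Module.nontrivial_of_finrank_pos (R := ℝ)
      (by rw [finrank_euclideanSpace_fin]; omega)
    simp [ae_iff]
  have hbd : ∀ f ∈ localSubspace s r a, ∀ᵐ p : Space s,
      ‖((‖p‖ ^ (-γ) * β p : ℝ) : ℂ) * (f : Space s → ℂ) p‖ ≤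
        C' * (‖(f : Space s → ℂ) p‖ + C * ‖f‖ *
          (ball (0 : Space s) 1).indicator (fun p => ‖p‖ ^ (a - γ)) p) := by
    intro f hf
    filter_upwards [hC f hf, hne] with p hp hp0
    have hpos : 0 < ‖p‖ := norm_pos_iff.2 hp0
    rw [norm_mul, Complex.norm_real, Real.norm_eq_abs, abs_mul,
      abs_of_nonneg (by positivity : 0 ≤ ‖p‖ ^ (-γ)), mul_comm (‖p‖ ^ (-γ)), mul_assoc]
    refine mul_le_mul (hC' p) ?_ (by positivity) hC'0
    by_cases hb : p ∈ ball (0 : Space s) 1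
    · rw [Set.indicator_of_mem hb]
      have h1 := hp (by simpa using hb)
      have h2 : ‖p‖ ^ (-γ) * ‖(f : Space s → ℂ) p‖ ≤ ‖p‖ ^ (-γ) * (C * ‖f‖ * ‖p‖ ^ a) := by
        gcongr
      have h3 : ‖p‖ ^ (-γ) * (C * ‖f‖ * ‖p‖ ^ a) = C * ‖f‖ * ‖p‖ ^ (a - γ) := by
        rw [sub_eq_add_neg, Real.rpow_add hpos]
        ring
      have := norm_nonneg ((f : Space s → ℂ) p)
      linarith
    · rw [Set.indicator_of_notMem hb, mul_zero, add_zero]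
      have h1 : 1 ≤ ‖p‖ := by simpa using hb
      have h2 : ‖p‖ ^ (-γ) ≤ 1 := Real.rpow_le_one_of_one_le_of_nonpos h1 (by linarith)
      exact mul_le_of_le_one_left (norm_nonneg _) h2
  have hmem : ∀ f : OneParticle s, MemLp (fun p => ((‖p‖ ^ (-γ) * β p : ℝ) : ℂ) *
      ((localSubspace s r a).starProjection f : Space s → ℂ) p) 2 volume := by
    intro f
    refine MemLp.of_le ((((Lp.memLp ((localSubspace s r a).starProjection f)).norm).add
      (hΦ.const_mul (C * ‖(localSubspace s r a).starProjection f‖))).const_mul C')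
      (hm.aestronglyMeasurable.mul (Lp.aestronglyMeasurable _)) ?_
    filter_upwards [hbd _ (Submodule.starProjection_apply_mem _ f)] with p hp
    exact hp.trans (le_abs_self _)
  let A : OneParticle s →ₗ[ℂ] OneParticle s :=
    { toFun := fun f => (hmem f).toLp _
      map_add' := fun f g => by
        apply Lp.ext
        filter_upwards [(hmem f).coeFn_toLp, (hmem g).coeFn_toLp, (hmem (f + g)).coeFn_toLp,
          Lp.coeFn_add ((localSubspace s r a).starProjection f)
            ((localSubspace s r a).starProjection g),
          Lp.coeFn_add ((hmem f).toLp _) ((hmem g).toLp _)] with p h1 h2 h3 h4 h5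
        rw [h3, h5, Pi.add_apply, h1, h2, map_add, h4, Pi.add_apply, mul_add]
      map_smul' := fun c f => by
        apply Lp.ext
        filter_upwards [(hmem f).coeFn_toLp, (hmem (c • f)).coeFn_toLp,
          Lp.coeFn_smul c ((localSubspace s r a).starProjection f),
          Lp.coeFn_smul c ((hmem f).toLp _)] with p h1 h2 h3 h4
        rw [RingHom.id_apply, h2, h4, Pi.smul_apply, h1, map_smul, h3, Pi.smul_apply, smul_eq_mul,
          smul_eq_mul]
        ring }
  refine ⟨A.mkContinuous (C' * (1 + C * ‖hΦ.toLp _‖)) fun f => ?_, fun f =>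
    (hmem f).coeFn_toLp⟩
  have hPf : ‖(localSubspace s r a).starProjection f‖ ≤ ‖f‖ :=
    Submodule.norm_starProjection_apply_le _ f
  set P := (localSubspace s r a).starProjection f with hP
  have hn1 : ‖((Lp.memLp P).norm).toLp _‖ = ‖P‖ := by
    rw [Lp.norm_toLp, eLpNorm_norm, Lp.norm_def]
  calc ‖A f‖ ≤ ‖C' • (((Lp.memLp P).norm).toLp _ + (C * ‖P‖) • hΦ.toLp _)‖ := by
        refine Lp.norm_le_norm_of_ae_le ?_
        filter_upwards [(hmem f).coeFn_toLp, hbd _ (Submodule.starProjection_apply_mem _ f),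
          Lp.coeFn_smul C' (((Lp.memLp P).norm).toLp _ + (C * ‖P‖) • hΦ.toLp _),
          Lp.coeFn_add (((Lp.memLp P).norm).toLp _) ((C * ‖P‖) • hΦ.toLp _),
          Lp.coeFn_smul (C * ‖P‖) (hΦ.toLp _), hΦ.coeFn_toLp, ((Lp.memLp P).norm).coeFn_toLp]
          with p h1 h2 h3 h4 h5 h6 h7
        change ‖((hmem f).toLp _ : Space s → ℂ) p‖ ≤ _
        rw [h1, h3, Pi.smul_apply, h4, Pi.add_apply, h5, Pi.smul_apply, h6, h7]
        exact h2.trans (le_abs_self _)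
    _ ≤ C' * (‖P‖ + C * ‖P‖ * ‖hΦ.toLp _‖) := by
        rw [norm_smul, Real.norm_of_nonneg hC'0]
        refine mul_le_mul_of_nonneg_left ((norm_add_le _ _).trans ?_) hC'0
        rw [hn1, norm_smul, Real.norm_of_nonneg (by positivity)]
    _ = C' * (1 + C * ‖hΦ.toLp _‖) * ‖P‖ := by ring
    _ ≤ C' * (1 + C * ‖hΦ.toLp _‖) * ‖f‖ := by gcongr

theorem continuous_ft {r : ℝ} {g : Space s → ℂ} (hg : IsTest r g) : Continuous (ft g) := by
  have h : ft g = fun p => (((2 * Real.pi) ^ (-(s : ℝ) / 2) : ℝ) : ℂ) *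
      (FourierTransform.fourier (hg.hasCompactSupport.toSchwartzMap hg.1))
        ((2 * Real.pi)⁻¹ • p) := by
    ext p
    rw [ft_eq_fourier, SchwartzMap.fourier_coe]
    rfl
  rw [h]
  exact continuous_const.mul ((SchwartzMap.continuous _).comp (continuous_const_smul _))

theorem norm_ft_le (g : Space s → ℂ) (p : Space s) :
    ‖ft g p‖ ≤ (2 * Real.pi) ^ (-(s : ℝ) / 2) * ∫ x, ‖g x‖ := by
  rw [ft, norm_mul, Complex.norm_real, Real.norm_of_nonneg (by positivity)]
  gcongr
  refine (norm_integral_le_integral_norm _).trans (le_of_eq (integral_congr_ae ?_))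
  filter_upwards with x
  rw [norm_mul, Complex.norm_exp]
  simp

theorem isTest_ofReal {r : ℝ} {h : Space s → ℝ} (h1 : ContDiff ℝ ∞ h)
    (h2 : tsupport h ⊆ ball 0 r) : IsTest r (fun x => (h x : ℂ)) :=
  ⟨Complex.ofRealCLM.contDiff.comp h1,
    (closure_mono (Function.support_comp_subset Complex.ofReal_zero h)).trans h2⟩

theorem abs_ftRe_le (h : Space s → ℝ) (p : Space s) :
    |ftRe h p| ≤ (2 * Real.pi) ^ (-(s : ℝ) / 2) * ∫ x, ‖(h x : ℂ)‖ :=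
  (Complex.abs_re_le_norm _).trans (norm_ft_le _ p)

theorem measurable_ftRe {r : ℝ} {h : Space s → ℝ} (h1 : ContDiff ℝ ∞ h)
    (h2 : tsupport h ⊆ ball 0 r) : Measurable (ftRe h) :=
  (Complex.continuous_re.comp (continuous_ft (isTest_ofReal h1 h2))).measurable

theorem opE_apply (hs : 3 ≤ s) (E r : ℝ) {a : ℝ} (ha : |a| ≤ 1 / 2) (f : OneParticle s) :
    (opE E (localSubspace s r a) f : Space s → ℂ) =ᵐ[volume]
      fun p => ((‖p‖ ^ (-(1 / 2) : ℝ) * Set.indicator (closedBall 0 E) (fun _ => (1 : ℝ)) p : ℝ) :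
        ℂ) * ((localSubspace s r a).starProjection f : Space s → ℂ) p := by
  have hs' : (3 : ℝ) ≤ s := by exact_mod_cast hs
  refine mulProj_apply hs r ha (by norm_num) (by linarith)
    (measurable_const.indicator measurableSet_closedBall) (C' := 1) (fun p => ?_) f
  by_cases hp : p ∈ closedBall (0 : Space s) E
  · simp [Set.indicator_of_mem hp]
  · simp [Set.indicator_of_notMem hp]

theorem opH_apply (hs : 3 ≤ s) {r : ℝ} {h : Space s → ℝ} (h1 : ContDiff ℝ ∞ h)
    (h2 : tsupport h ⊆ ball 0 r) {γ : ℝ} (hγ0 : 0 ≤ γ) (hγ : γ < ((s : ℝ) - 1) / 2)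
    {a : ℝ} (ha : |a| ≤ 1 / 2) (f : OneParticle s) :
    (opH h γ (localSubspace s r a) f : Space s → ℂ) =ᵐ[volume]
      fun p => ((‖p‖ ^ (-γ) * ftRe h p ^ (1 / 2 : ℝ) : ℝ) : ℂ) *
        ((localSubspace s r a).starProjection f : Space s → ℂ) p := by
  refine mulProj_apply hs r ha hγ0 hγ ((measurable_ftRe h1 h2).pow_const _)
    (C' := ((2 * Real.pi) ^ (-(s : ℝ) / 2) * ∫ x, ‖(h x : ℂ)‖) ^ (1 / 2 : ℝ)) (fun p => ?_) f
  exact (Real.abs_rpow_le_abs_rpow _ _).trans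
    (Real.rpow_le_rpow (abs_nonneg _) (abs_ftRe_le h p) (by norm_num))

theorem opV_apply (hs : 3 ≤ s) {r : ℝ} {h : Space s → ℝ} (h1 : ContDiff ℝ ∞ h)
    (h2 : tsupport h ⊆ ball 0 r) {a : ℝ} (ha : |a| ≤ 1 / 2) (f : OneParticle s) :
    (opV h (localSubspace s r a) f : Space s → ℂ) =ᵐ[volume]
      fun p => ((‖p‖ ^ (-(1 / 2) : ℝ) * ftRe h p : ℝ) : ℂ) *
        ((localSubspace s r a).starProjection f : Space s → ℂ) p := by
  have hs' : (3 : ℝ) ≤ s := by exact_mod_cast hs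
  exact mulProj_apply hs r ha (by norm_num) (by linarith) (measurable_ftRe h1 h2)
    (abs_ftRe_le h) f

end MasslessField

end

/-! For `f = ω^a g̃` in the core of `𝓛^±`, with `a = ∓1/2 = 1/2 - k` and `k ∈ {0, 1}`, the vector
`h̃ ω^{-1/2} f` is `ω^{-k} ũ` with `ũ = h̃ g̃`, where `u` is a test function supported in the ball
of radius `2r`. The two-point function is therefore `∫ ũ(p) conj(ũ(p)) |p|^{-2k} e^{i(|p| x⁰ - p·x)}
dp`.

Decay comes from a contour shift. Write `p = q + y n` with `n` the direction of `x`, `q ⊥ n` and `ρ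
= |q|`. Along the line, `ũ` and its conjugate extend to entire functions of `y`, while `√(y² + ρ²)`
is holomorphic in `|Im y| < ρ`. Moving `y` to `y - iη` gains `e^{-|x|η}` from the plane wave and
loses at most `e^{|x⁰|η}`, since `|Im √(w² + ρ²)| ≤ |Im w|` (`norm_integral_line_le`). With `η =
ρ/(2(1+ρ))` and `d = |x| - |x⁰|`, the factor `e^{-dη}` is bounded by a multiple of `(1+d)^{-κ}
((1+ρ)/ρ)^κ`. The line integral costs a further `1/ρ` when `k = 1`. What remains is `∫ ρ^{-κ-1}`
near the origin of `ℝ^{s-1}`, which is finite exactly for `κ < s - 2`; this fixes the exponent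
(`exists_norm_integral_twoPoint_le`).

The factor `t²` comes from bounding `ũ` in the complex strip by `‖T_{h,±} f‖`
(`exists_norm_ft_exp_mul_le_norm`). As `u` has support in a fixed ball, its complex continuation is
controlled by a rapidly decreasing kernel applied to `|ũ|`. Since `ũ = h̃^{1/2} ω^{γ-a} · (T_{h,±}
f)`, Cauchy–Schwarz gives the bound, uniformly in `γ`. By continuity it passes to all of `𝓛^±`, and
`‖T_{h,±} e‖ ≤ ‖T e‖ ≤ |t|`. -/

namespace MasslessField

open scoped FourierTransform SchwartzMap

variable {s : ℕ}

/-! ### Convolution of test functions and uniform Fourier decay -/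

open scoped Pointwise in
/-- Products of Fourier transforms of test functions are Fourier transforms of test functions. -/
theorem IsTest.exists_ft_eq_mul {r₁ r₂ : ℝ} {f g : Space s → ℂ} (hf : IsTest r₁ f)
    (hg : IsTest r₂ g) :
    ∃ u : Space s → ℂ, IsTest (r₁ + r₂) u ∧ ∀ p, ft u p = ft f p * ft g p := by
  set c : ℂ := (((2 * Real.pi) ^ (-(s : ℝ) / 2) : ℝ) : ℂ) with hc
  let u₀ : Space s → ℂ := MeasureTheory.convolution f g (ContinuousLinearMap.mul ℂ ℂ) volume
  have hsmooth : ContDiff ℝ ∞ u₀ := by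
    have := hg.hasCompactSupport.contDiff_convolution_right (n := ⊤)
      (ContinuousLinearMap.mul ℝ ℂ)
      (hf.1.continuous.locallyIntegrable (μ := volume)) hg.1
    exact this
  have hsupp : tsupport u₀ ⊆ ball 0 (r₁ + r₂) := by
    have hcpt : IsCompact (tsupport f + tsupport g) :=
      IsCompact.add hf.hasCompactSupport hg.hasCompactSupport
    refine (closure_minimal (?_ : Function.support u₀ ⊆ tsupport f + tsupport g)
      hcpt.isClosed).trans ?_
    · exact (support_convolution_subset _).trans
        (Set.add_subset_add (subset_tsupport f) (subset_tsupport g))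
    · rintro _ ⟨x, hx, y, hy, rfl⟩
      have h1 := hf.2 hx
      have h2 := hg.2 hy
      rw [mem_ball_zero_iff] at h1 h2 ⊢
      exact (norm_add_le x y).trans_lt (add_lt_add h1 h2)
  -- The unitary normalisation turns convolution into `(2π)^{s/2}` times the product; the scalar `c`
  -- cancels this.
  refine ⟨c • u₀, ⟨contDiff_const.smul hsmooth,
    (closure_mono (Function.support_const_smul_subset c u₀)).trans hsupp⟩, fun p => ?_⟩
  rw [ft_smul, ft_eq_fourier, ft_eq_fourier, ft_eq_fourier,
    Real.fourier_mul_convolution_eq hf.integrable hg.integrable, ← hc]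
  ring

/-- The partial function is a translate of `Ψ` composed with the inclusion `y ↦ (0, y)`, which has
norm at most one. This makes bounds on derivatives in `x` uniform in the parameter `v`, by
compactness in the product. -/
theorem norm_iteratedFDeriv_curry_le {E F G : Type*} [NormedAddCommGroup E] [NormedSpace ℝ E]
    [NormedAddCommGroup F] [NormedSpace ℝ F] [NormedAddCommGroup G] [NormedSpace ℝ G]
    {Ψ : E × F → G} (hΨ : ContDiff ℝ ∞ Ψ) (n : ℕ) (v : E) (x : F) :
    ‖iteratedFDeriv ℝ n (fun y => Ψ (v, y)) x‖ ≤ ‖iteratedFDeriv ℝ n Ψ (v, x)‖ := by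
  have h1 : (fun y => Ψ (v, y)) =
      (fun q => Ψ (q + (v, 0))) ∘ (ContinuousLinearMap.inr ℝ E F) := by
    ext y
    simp
  have h2 : ContDiff ℝ ∞ fun q => Ψ (q + (v, 0)) :=
    hΨ.comp (contDiff_id.add contDiff_const)
  rw [h1, ContinuousLinearMap.iteratedFDeriv_comp_right _ h2 _ (by exact_mod_cast le_top),
    iteratedFDeriv_comp_add_right]
  refine (ContinuousMultilinearMap.norm_compContinuousLinearMap_le _ _).trans ?_
  have h3 : ∏ _i : Fin n, ‖ContinuousLinearMap.inr ℝ E F‖ ≤ 1 :=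
    Finset.prod_le_one (fun _ _ => norm_nonneg _)
      (fun _ _ => ContinuousLinearMap.norm_inr_le_one ℝ E F)
  have h4 : ContinuousLinearMap.inr ℝ E F x + (v, 0) = (v, x) := by simp
  rw [h4]
  exact mul_le_of_le_one_right (norm_nonneg _) h3

theorem contDiff_exp_inner_mul {b : Space s → ℝ} (hb : ContDiff ℝ ∞ b) :
    ContDiff ℝ ∞ fun q : Space s × Space s =>
      ((Real.exp (inner ℝ q.1 q.2) * b q.2 : ℝ) : ℂ) :=
  Complex.ofRealCLM.contDiff.comp
    ((Real.contDiff_exp.comp (contDiff_fst.inner ℝ contDiff_snd)).mul (hb.comp contDiff_snd))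

/-- Rapid decay of Fourier transforms of `e^{⟨v, x⟩} b(x)`, uniformly in the unit ball. -/
theorem exists_fourier_exp_mul_le {b : Space s → ℝ} (hb : ContDiff ℝ ∞ b)
    (hbc : HasCompactSupport b) (M : ℕ) :
    ∃ C : ℝ, 0 ≤ C ∧ ∀ v : Space s, ‖v‖ ≤ 1 → ∀ ξ,
      (1 + ‖ξ‖) ^ M * ‖𝓕 (fun x : Space s => ((Real.exp (inner ℝ v x) * b x : ℝ) : ℂ)) ξ‖ ≤ C := by
  set Ψ : Space s × Space s → ℂ := fun q => ((Real.exp (inner ℝ q.1 q.2) * b q.2 : ℝ) : ℂ) with hΨd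
  have hΨ : ContDiff ℝ ∞ Ψ := contDiff_exp_inner_mul hb
  have hcs : ∀ v, HasCompactSupport fun x => Ψ (v, x) := fun v =>
    (hbc.mul_left (f := fun x => Real.exp (inner ℝ v x))).comp_left Complex.ofReal_zero
  have hsm : ∀ v, ContDiff ℝ ∞ fun x => Ψ (v, x) := fun v =>
    hΨ.comp (contDiff_const.prodMk contDiff_id)
  have hint : ∀ n v, Integrable fun x => ‖iteratedFDeriv ℝ n (fun y => Ψ (v, y)) x‖ := by
    intro n v
    exact (((hsm v).continuous_iteratedFDeriv (by exact_mod_cast le_top)).integrable_of_hasCompactSupport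
      ((hcs v).iteratedFDeriv n)).norm
  have hbd : ∀ n : ℕ, ∃ C : ℝ, 0 ≤ C ∧ ∀ v : Space s, ‖v‖ ≤ 1 →
      ∫ x, ‖iteratedFDeriv ℝ n (fun y => Ψ (v, y)) x‖ ≤ C := by
    intro n
    -- Uniformity in `v`: the joint derivative is continuous, hence bounded on this compact set, and
    -- the support in `x` does not depend on `v`.
    have hK : IsCompact (closedBall (0 : Space s) 1 ×ˢ tsupport b) :=
      (isCompact_closedBall _ _).prod hbc
    obtain ⟨D, hD⟩ := hK.exists_bound_of_continuousOn
      (hΨ.continuous_iteratedFDeriv (m := n) (by exact_mod_cast le_top)).continuousOn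
    refine ⟨|D| * volume.real (tsupport b), by positivity, fun v hv => ?_⟩
    have hsub : Function.support (fun x => ‖iteratedFDeriv ℝ n (fun y => Ψ (v, y)) x‖) ⊆
        tsupport b := by
      intro x hx
      have h1 : Function.support (fun y => Ψ (v, y)) ⊆ Function.support b :=
        fun y hy hby => hy (by simp [hΨd, hby])
      exact closure_mono h1 (support_iteratedFDeriv_subset n (norm_ne_zero_iff.1 hx))
    rw [← setIntegral_eq_integral_of_forall_compl_eq_zero
      (fun x hx => by_contra fun h => hx (hsub h))]
    refine (Real.le_norm_self _).trans (norm_setIntegral_le_of_norm_le_const hbc.measure_lt_top ?_)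
    intro x hx
    rw [norm_norm]
    exact (norm_iteratedFDeriv_curry_le hΨ n v x).trans
      ((hD (v, x) ⟨by simpa using hv, hx⟩).trans (le_abs_self D))
  have hpow : ∀ n : ℕ, ∃ C : ℝ, 0 ≤ C ∧ ∀ v : Space s, ‖v‖ ≤ 1 → ∀ ξ,
      ‖ξ‖ ^ n * ‖𝓕 (fun x => Ψ (v, x)) ξ‖ ≤ C := by
    intro n
    choose D hD0 hD using hbd
    refine ⟨2 ^ n * ∑ j ∈ Finset.range (n + 1), D j,
      mul_nonneg (by positivity) (Finset.sum_nonneg fun j _ => hD0 j), fun v hv ξ => ?_⟩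
    -- With `k = 0` no moments in `x` occur: the power `‖ξ‖ ^ n` is traded for `x`-derivatives of
    -- order at most `n`.
    have := Real.pow_mul_norm_iteratedFDeriv_fourier_le (K := 0) (N := ⊤) (k := 0) (n := n)
      (hsm v) (fun k m hk _ => by
        obtain rfl : k = 0 := by simpa using hk
        simpa using hint m v) le_rfl le_top ξ
    rw [norm_iteratedFDeriv_zero] at this
    refine this.trans ?_
    simp only [pow_zero, one_mul, zero_add, Finset.range_one, Finset.singleton_product,
      Finset.sum_map, Function.Embedding.coeFn_mk, Nat.cast_zero, mul_zero]
    gcongr with j hj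
    exact hD j v hv
  obtain ⟨C₀, hC₀, h₀⟩ := hpow 0
  obtain ⟨C₁, hC₁, h₁⟩ := hpow M
  refine ⟨2 ^ (M - 1) * (C₀ + C₁), by positivity, fun v hv ξ => ?_⟩
  have h2 := h₀ v hv ξ
  have h3 := h₁ v hv ξ
  have h4 : (1 + ‖ξ‖) ^ M ≤ 2 ^ (M - 1) * (1 ^ M + ‖ξ‖ ^ M) :=
    add_pow_le zero_le_one (norm_nonneg ξ) M
  calc (1 + ‖ξ‖) ^ M * ‖𝓕 (fun x => Ψ (v, x)) ξ‖
      ≤ 2 ^ (M - 1) * (1 ^ M + ‖ξ‖ ^ M) * ‖𝓕 (fun x => Ψ (v, x)) ξ‖ := by gcongr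
    _ = 2 ^ (M - 1) * (‖ξ‖ ^ 0 * ‖𝓕 (fun x => Ψ (v, x)) ξ‖ +
        ‖ξ‖ ^ M * ‖𝓕 (fun x => Ψ (v, x)) ξ‖) := by rw [one_pow, pow_zero]; ring
    _ ≤ 2 ^ (M - 1) * (C₀ + C₁) := by gcongr

end MasslessField
-- Complex continuation of Fourier transforms of test functions
namespace MasslessField

open scoped FourierTransform SchwartzMap

variable {s : ℕ}

/-- Fourier transforms of functions supported in a ball, continued by `v` into the complex domain,
are controlled by their values at real momenta. -/
theorem exists_norm_ft_exp_mul_le (s : ℕ) (R : ℝ) (M : ℕ) :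
    ∃ C : ℝ, 0 ≤ C ∧ ∀ u : Space s → ℂ, IsTest R u → ∀ v : Space s, ‖v‖ ≤ 1 → ∀ p,
      ‖ft (fun x => ((Real.exp (inner ℝ v x) : ℝ) : ℂ) * u x) p‖ ≤
        ∫ q, C * ((1 + ‖q - p‖) ^ M)⁻¹ * ‖ft u q‖ := by
  -- A cut-off equal to one on the support of `u`, so that `e^{⟨v,x⟩} u = (e^{⟨v,x⟩} b) u`. The
  -- maximum makes the radii positive for every `R`.
  let b : ContDiffBump (0 : Space s) :=
    ⟨max R 1, max R 1 + 1, lt_of_lt_of_le one_pos (le_max_right _ _), by linarith⟩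
  obtain ⟨C, hC0, hC⟩ := exists_fourier_exp_mul_le b.contDiff b.hasCompactSupport M
  have hrep : ∀ u : Space s → ℂ, IsTest R u → ∀ v : Space s, ‖v‖ ≤ 1 → ∀ ξ,
      ‖𝓕 (fun x => ((Real.exp (inner ℝ v x) : ℝ) : ℂ) * u x) ξ‖ ≤
        ∫ η, C * ((1 + ‖η - ξ‖) ^ M)⁻¹ * ‖𝓕 u η‖ := by
    intro u hu v hv ξ
    have hbc : HasCompactSupport fun x : Space s => ((Real.exp (inner ℝ v x) * b x : ℝ) : ℂ) :=
      (b.hasCompactSupport.mul_left (f := fun x => Real.exp (inner ℝ v x))).comp_left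
        Complex.ofReal_zero
    have hbs : ContDiff ℝ ∞ fun x : Space s => ((Real.exp (inner ℝ v x) * b x : ℝ) : ℂ) :=
      (contDiff_exp_inner_mul b.contDiff).comp (contDiff_const.prodMk contDiff_id)
    have hkc : HasCompactSupport
        (fun x : Space s => Complex.exp (((2 * Real.pi * inner ℝ x ξ : ℝ) : ℂ) * Complex.I) *
          ((Real.exp (inner ℝ v x) * b x : ℝ) : ℂ)) := hbc.mul_left
    have hks : ContDiff ℝ ∞
        (fun x : Space s => Complex.exp (((2 * Real.pi * inner ℝ x ξ : ℝ) : ℂ) * Complex.I) *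
          ((Real.exp (inner ℝ v x) * b x : ℝ) : ℂ)) := by
      refine ContDiff.mul (ContDiff.cexp (ContDiff.mul ?_ contDiff_const)) hbs
      refine Complex.ofRealCLM.contDiff.comp (contDiff_const.mul ?_)
      exact contDiff_id.inner ℝ contDiff_const
    let k : 𝓢(Space s, ℂ) := hkc.toSchwartzMap hks
    let U : 𝓢(Space s, ℂ) := hu.hasCompactSupport.toSchwartzMap hu.1
    have hk : ∀ η, 𝓕 k η =
        𝓕 (fun x : Space s => ((Real.exp (inner ℝ v x) * b x : ℝ) : ℂ)) (η - ξ) := by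
      intro η
      rw [SchwartzMap.fourier_coe, Real.fourier_eq', Real.fourier_eq']
      congr 1
      ext x
      simp only [smul_eq_mul, k, HasCompactSupport.toSchwartzMap_toFun, ← mul_assoc,
        ← Complex.exp_add, inner_sub_right]
      congr 2
      push_cast
      ring
    -- The value at `ξ` is an `L²` pairing of `u` with the modulated cut-off `k`. Parseval turns it
    -- into an integral against `𝓕 k`, a translate by `ξ` of a rapidly decreasing function.
    have hU : 𝓕 (fun x => ((Real.exp (inner ℝ v x) : ℝ) : ℂ) * u x) ξ =
        ∫ x, inner ℂ (k x) (U x) := by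
      rw [Real.fourier_eq']
      congr 1
      ext x
      rw [RCLike.inner_apply, smul_eq_mul]
      simp only [k, U, HasCompactSupport.toSchwartzMap_toFun]
      by_cases hx : x ∈ ball (0 : Space s) R
      · have : b x = 1 := b.one_of_mem_closedBall
          (ball_subset_closedBall (ball_subset_ball (le_max_left _ _) hx))
        rw [this, map_mul, ← Complex.exp_conj, Complex.conj_ofReal, map_mul, Complex.conj_ofReal,
          Complex.conj_I, mul_one]
        push_cast
        ring_nf
      · have : u x = 0 := image_eq_zero_of_notMem_tsupport (fun h => hx (hu.2 h))
        simp [this]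
    have hU' : ∀ η, 𝓕 u η = 𝓕 U η := fun η => by rw [SchwartzMap.fourier_coe]; rfl
    rw [hU, ← SchwartzMap.integral_inner_fourier_fourier]
    refine (norm_integral_le_integral_norm _).trans (integral_mono_of_nonneg
      (Filter.Eventually.of_forall fun _ => norm_nonneg _) ?_
      (Filter.Eventually.of_forall fun η => ?_))
    · have h1 : Integrable (fun η => ‖𝓕 u η‖) := by
        simp only [hU']
        exact ((𝓕 U).integrable (μ := volume)).norm
      refine h1.bdd_mul (c := C) (Continuous.aestronglyMeasurable ?_)
        (Filter.Eventually.of_forall fun η => ?_)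
      · exact continuous_const.mul (Continuous.inv₀ (by fun_prop) fun η => by positivity)
      · rw [Real.norm_of_nonneg (by positivity)]
        exact mul_le_of_le_one_right hC0 (inv_le_one_of_one_le₀ (one_le_pow₀ (by simp)))
    · simp only [hU']
      refine (norm_inner_le_norm _ _).trans ?_
      gcongr
      rw [hk, ← div_eq_mul_inv, le_div_iff₀ (by positivity), mul_comm]
      exact hC v hv _
  set a : ℝ := (2 * Real.pi)⁻¹ with ha
  have ha0 : 0 < a := by positivity
  have ha1 : a ≤ 1 := inv_le_one_of_one_le₀ (by linarith [Real.pi_gt_three])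
  refine ⟨a ^ s * (C * (a ^ M)⁻¹), by positivity, fun u hu v hv p => ?_⟩
  set c : ℝ := ‖(((2 * Real.pi) ^ (-(s : ℝ) / 2) : ℝ) : ℂ)‖ with hc
  have hsub : ∫ η, C * ((1 + ‖η - a • p‖) ^ M)⁻¹ * ‖𝓕 u η‖ =
      a ^ s * ∫ q : Space s, C * ((1 + ‖a • q - a • p‖) ^ M)⁻¹ * ‖𝓕 u (a • q)‖ := by
    rw [Measure.integral_comp_smul (volume : Measure (Space s))
      (fun η => C * ((1 + ‖η - a • p‖) ^ M)⁻¹ * ‖𝓕 u η‖) a, finrank_euclideanSpace_fin,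
      smul_eq_mul, abs_of_pos (by positivity), ← mul_assoc, mul_inv_cancel₀ (by positivity),
      one_mul]
  have hint : Integrable fun q => ‖ft u q‖ := by
    let U : 𝓢(Space s, ℂ) := hu.hasCompactSupport.toSchwartzMap hu.1
    have h1 := (((𝓕 U).integrable (μ := volume)).comp_smul (R := a) ha0.ne').norm.const_mul c
    refine h1.congr (Filter.Eventually.of_forall fun q => ?_)
    simp only [ft_eq_fourier, norm_mul, ← ha, ← hc]
    rw [SchwartzMap.fourier_coe]
    rfl
  calc ‖ft (fun x => ((Real.exp (inner ℝ v x) : ℝ) : ℂ) * u x) p‖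
      ≤ c * ∫ η, C * ((1 + ‖η - a • p‖) ^ M)⁻¹ * ‖𝓕 u η‖ := by
        rw [ft_eq_fourier, norm_mul, ← ha, ← hc]
        gcongr
        exact hrep u hu v hv _
    _ = ∫ q : Space s, a ^ s * (C * ((1 + ‖a • q - a • p‖) ^ M)⁻¹) * ‖ft u q‖ := by
        rw [hsub, ← mul_assoc, ← integral_const_mul]
        congr 1
        ext q
        rw [ft_eq_fourier, norm_mul, ← ha, ← hc]
        ring
    _ ≤ ∫ q, a ^ s * (C * (a ^ M)⁻¹) * ((1 + ‖q - p‖) ^ M)⁻¹ * ‖ft u q‖ := by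
        refine integral_mono_of_nonneg (Filter.Eventually.of_forall fun q => by positivity) ?_
          (Filter.Eventually.of_forall fun q => ?_)
        · refine hint.bdd_mul (c := a ^ s * (C * (a ^ M)⁻¹)) (Continuous.aestronglyMeasurable ?_)
            (Filter.Eventually.of_forall fun η => ?_)
          · exact continuous_const.mul (Continuous.inv₀ (by fun_prop) fun η => by positivity)
          · rw [Real.norm_of_nonneg (by positivity)]
            exact mul_le_of_le_one_right (by positivity)
              (inv_le_one_of_one_le₀ (one_le_pow₀ (by simp)))
        -- As `a = (2π)⁻¹ ≤ 1`, passing from frequency to momentum costs only the factor `a ^ (-M)`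
        -- in the kernel.
        · have h1 : a * (1 + ‖q - p‖) ≤ 1 + ‖a • q - a • p‖ := by
            rw [← smul_sub, norm_smul, Real.norm_of_nonneg ha0.le]
            linarith
          have h2 : ((1 + ‖a • q - a • p‖) ^ M)⁻¹ ≤ (a ^ M)⁻¹ * ((1 + ‖q - p‖) ^ M)⁻¹ := by
            rw [← mul_inv, ← mul_pow]
            gcongr
          refine mul_le_mul_of_nonneg_right ?_ (norm_nonneg _)
          rw [mul_assoc (a ^ s) _ (_⁻¹), mul_assoc C]
          gcongr

/-- Rapid decay of Fourier transforms of test functions. -/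
theorem IsTest.exists_norm_ft_le {R : ℝ} {u : Space s → ℂ} (hu : IsTest R u) (M : ℕ) :
    ∃ C : ℝ, 0 ≤ C ∧ ∀ p, ‖ft u p‖ ≤ C * ((1 + ‖p‖) ^ M)⁻¹ := by
  let U : 𝓢(Space s, ℂ) := hu.hasCompactSupport.toSchwartzMap hu.1
  obtain ⟨C₀, hC₀, h₀⟩ := (𝓕 U).decay 0 0
  obtain ⟨C₁, hC₁, h₁⟩ := (𝓕 U).decay M 0
  set a : ℝ := (2 * Real.pi)⁻¹ with ha
  have ha0 : 0 < a := by positivity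
  set c : ℝ := ‖(((2 * Real.pi) ^ (-(s : ℝ) / 2) : ℝ) : ℂ)‖ with hc
  refine ⟨c * (2 ^ (M - 1) * (C₀ + (a ^ M)⁻¹ * C₁)), by positivity, fun p => ?_⟩
  have h2 := h₀ (a • p)
  have h3 := h₁ (a • p)
  rw [norm_iteratedFDeriv_zero] at h2 h3
  rw [norm_smul, Real.norm_of_nonneg ha0.le, mul_pow, mul_assoc, ← le_div_iff₀' (by positivity)]
    at h3
  have h4 : (1 + ‖p‖) ^ M ≤ 2 ^ (M - 1) * (1 ^ M + ‖p‖ ^ M) :=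
    add_pow_le zero_le_one (norm_nonneg p) M
  have h5 : ft u p = (((2 * Real.pi) ^ (-(s : ℝ) / 2) : ℝ) : ℂ) * 𝓕 U (a • p) := by
    rw [ft_eq_fourier, SchwartzMap.fourier_coe]
    rfl
  rw [← div_eq_mul_inv, le_div_iff₀ (by positivity), h5, norm_mul, ← hc, mul_assoc]
  refine mul_le_mul_of_nonneg_left ?_ (norm_nonneg _)
  calc ‖𝓕 U (a • p)‖ * (1 + ‖p‖) ^ M
      ≤ ‖𝓕 U (a • p)‖ * (2 ^ (M - 1) * (1 ^ M + ‖p‖ ^ M)) := by gcongr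
    _ = 2 ^ (M - 1) * (‖p‖ ^ 0 * ‖𝓕 U (a • p)‖ + ‖p‖ ^ M * ‖𝓕 U (a • p)‖) := by
        rw [one_pow, pow_zero]; ring
    _ ≤ 2 ^ (M - 1) * (C₀ + (a ^ M)⁻¹ * C₁) := by
        rw [div_eq_inv_mul] at h3
        simp only [pow_zero, one_mul] at h2 ⊢
        gcongr

end MasslessField
-- Control of the continued function by the norm of `T_{h,±}`
namespace MasslessField

variable {s : ℕ}

theorem integral_mul_norm_le {A : Space s → ℝ} (hA : MemLp A 2) (hA0 : ∀ q, 0 ≤ A q)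
    (φ : OneParticle s) :
    ∫ q, A q * ‖(φ : Space s → ℂ) q‖ ≤ (∫ q, A q ^ (2 : ℝ)) ^ (1 / 2 : ℝ) * ‖φ‖ := by
  have hφ : ‖φ‖ = (∫ q, ‖(φ : Space s → ℂ) q‖ ^ (2 : ℝ)) ^ (1 / 2 : ℝ) := by
    rw [Lp.norm_def, (Lp.memLp φ).eLpNorm_eq_integral_rpow_norm (by simp) (by simp),
      ENNReal.toReal_ofReal (by positivity)]
    simp
  rw [hφ]
  refine integral_mul_le_Lp_mul_Lq_of_nonneg Real.HolderConjugate.two_two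
    (Filter.Eventually.of_forall hA0) (Filter.Eventually.of_forall fun q => norm_nonneg _) ?_ ?_
  · rwa [ENNReal.ofReal_ofNat]
  · rw [ENNReal.ofReal_ofNat]
    exact (Lp.memLp φ).norm

theorem ft_eq_ftRe {h : Space s → ℝ}
    (h_pos : ∀ p, ∃ y : ℝ, 0 < y ∧ ft (fun x => (h x : ℂ)) p = (y : ℂ)) (p : Space s) :
    0 < ftRe h p ∧ ft (fun x => (h x : ℂ)) p = (ftRe h p : ℂ) := by
  obtain ⟨y, hy, hp⟩ := h_pos p
  rw [ftRe, hp, Complex.ofReal_re]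
  exact ⟨hy, rfl⟩

theorem ae_ne_zero (hs : 1 ≤ s) : ∀ᵐ p : Space s, p ≠ 0 := by
  have : Nontrivial (Space s) := Module.nontrivial_of_finrank_pos (R := ℝ)
    (by rw [finrank_euclideanSpace_fin]; omega)
  simp [ae_iff]

/-- `h̃ g̃`, continued into the complex domain, is bounded by the norm of `ω^{-γ} h̃^{1/2} ω^a g̃`. -/
theorem exists_norm_ft_exp_mul_le_norm (hs : 1 ≤ s) {r : ℝ} {h : Space s → ℝ}
    (h_smooth : ContDiff ℝ ∞ h) (h_supp : tsupport h ⊆ ball 0 r)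
    (h_pos : ∀ p, ∃ y : ℝ, 0 < y ∧ ft (fun x => (h x : ℂ)) p = (y : ℂ)) (M : ℕ) :
    ∃ C : ℝ, 0 ≤ C ∧ ∀ γ a : ℝ, 1 / 2 ≤ γ → γ < ((s : ℝ) - 1) / 2 → |a| ≤ 1 / 2 →
      ∀ (g u : Space s → ℂ) (φ : OneParticle s), IsTest (r + r) u →
        (∀ p, ft u p = ft (fun x => (h x : ℂ)) p * ft g p) →
        ((φ : Space s → ℂ) =ᵐ[volume] fun p => ((‖p‖ ^ (-γ) * ftRe h p ^ (1 / 2 : ℝ) : ℝ) : ℂ) *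
          (((‖p‖ ^ a : ℝ) : ℂ) * ft g p)) →
        ∀ v : Space s, ‖v‖ ≤ 1 → ∀ p,
          ‖ft (fun x => ((Real.exp (inner ℝ v x) : ℝ) : ℂ) * u x) p‖ ≤
            C * ‖φ‖ * ((1 + ‖p‖) ^ M)⁻¹ := by
  obtain ⟨C, hC0, hC⟩ := exists_norm_ft_exp_mul_le s (r + r) M
  -- The square root of `h̃` keeps half of this decay: `M` powers for the conclusion, `s` to absorb
  -- `‖q‖ ^ (γ - a)`, and `s` for the square-integrable weight `A`.
  obtain ⟨D, hD0, hD⟩ := (isTest_ofReal h_smooth h_supp).exists_norm_ft_le (2 * (M + 2 * s))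
  set A : Space s → ℝ := fun q => ((1 + ‖q‖) ^ s)⁻¹ with hA
  have hA0 : ∀ q, 0 ≤ A q := fun q => by positivity
  have hAm : Continuous A := Continuous.inv₀ (by fun_prop) fun q => by positivity
  have hA2 : MemLp A 2 := by
    rw [memLp_two_iff_integrable_sq hAm.aestronglyMeasurable]
    have := integrable_one_add_norm (E := Space s) (μ := volume) (r := ((2 * s : ℕ) : ℝ))
      (by rw [finrank_euclideanSpace_fin]; exact_mod_cast (by omega : s < 2 * s))
    refine this.congr (Filter.Eventually.of_forall fun q => ?_)
    simp only [hA]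
    rw [Real.rpow_neg (by positivity), Real.rpow_natCast, inv_pow, ← pow_mul, mul_comm]
  set N : ℝ := (∫ q, A q ^ (2 : ℝ)) ^ (1 / 2 : ℝ) with hN
  have hN0 : 0 ≤ N := Real.rpow_nonneg (integral_nonneg fun q => by positivity) _
  refine ⟨C * D ^ (1 / 2 : ℝ) * N, by positivity, ?_⟩
  intro γ a hγ1 hγ2 ha g u φ hu hug hφ v hv p
  obtain ⟨ha1, ha2⟩ := abs_le.1 ha
  have hW : ∀ q : Space s, ftRe h q ^ (1 / 2 : ℝ) * ‖q‖ ^ (γ - a) ≤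
      D ^ (1 / 2 : ℝ) * (((1 + ‖q‖) ^ M)⁻¹ * A q) := by
    intro q
    obtain ⟨h1, h2⟩ := ft_eq_ftRe h_pos q
    have h3 : ftRe h q ≤ D * ((1 + ‖q‖) ^ (2 * (M + 2 * s)))⁻¹ := by
      have := hD q
      rwa [h2, Complex.norm_real, Real.norm_of_nonneg h1.le] at this
    have h4 : ftRe h q ^ (1 / 2 : ℝ) ≤ D ^ (1 / 2 : ℝ) * ((1 + ‖q‖) ^ (M + 2 * s))⁻¹ := by
      refine (Real.rpow_le_rpow h1.le h3 (by norm_num)).trans (le_of_eq ?_)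
      rw [Real.mul_rpow hD0 (by positivity)]
      congr 1
      rw [← Real.sqrt_eq_rpow, mul_comm 2, pow_mul, ← inv_pow, Real.sqrt_sq (by positivity)]
    -- Uniformity in `γ`: the ranges of `γ` and `a` give `0 ≤ γ - a ≤ s`.
    have h5 : ‖q‖ ^ (γ - a) ≤ (1 + ‖q‖) ^ s := by
      rw [← Real.rpow_natCast]
      have h6 := norm_nonneg q
      exact (Real.rpow_le_rpow h6 (by linarith) (by linarith)).trans
        (Real.rpow_le_rpow_of_exponent_le (by linarith) (by linarith))
    calc ftRe h q ^ (1 / 2 : ℝ) * ‖q‖ ^ (γ - a)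
        ≤ D ^ (1 / 2 : ℝ) * ((1 + ‖q‖) ^ (M + 2 * s))⁻¹ * (1 + ‖q‖) ^ s := by gcongr
      _ = D ^ (1 / 2 : ℝ) * (((1 + ‖q‖) ^ M)⁻¹ * A q) := by
        have : (1 + ‖q‖) ≠ 0 := by positivity
        simp only [hA]
        rw [pow_add, two_mul, pow_add]
        field_simp
  have hint : Integrable fun q => A q * ‖(φ : Space s → ℂ) q‖ :=
    hA2.integrable_mul (Lp.memLp φ).norm
  calc ‖ft (fun x => ((Real.exp (inner ℝ v x) : ℝ) : ℂ) * u x) p‖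
      ≤ ∫ q, C * ((1 + ‖q - p‖) ^ M)⁻¹ * ‖ft u q‖ := hC u hu v hv p
    _ ≤ ∫ q, C * D ^ (1 / 2 : ℝ) * ((1 + ‖p‖) ^ M)⁻¹ * (A q * ‖(φ : Space s → ℂ) q‖) := by
      refine integral_mono_of_nonneg (Filter.Eventually.of_forall fun q => by positivity)
        (hint.const_mul _) ?_
      filter_upwards [hφ, ae_ne_zero hs] with q hq hq0
      have hpos : 0 < ‖q‖ := norm_pos_iff.2 hq0
      obtain ⟨h1, h2⟩ := ft_eq_ftRe h_pos q
      -- Half of `h̃` and the powers of `‖q‖` are moved into `φ`; the cancellation of powers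
      -- requires `q ≠ 0`.
      have h3 : ‖ft u q‖ =
          ftRe h q ^ (1 / 2 : ℝ) * ‖q‖ ^ (γ - a) * ‖(φ : Space s → ℂ) q‖ := by
        rw [hq, hug, h2, norm_mul, norm_mul, norm_mul, Complex.norm_real, Complex.norm_real,
          Complex.norm_real, Real.norm_of_nonneg h1.le, Real.norm_of_nonneg (by positivity),
          Real.norm_of_nonneg (by positivity)]
        have h4 : ftRe h q ^ (1 / 2 : ℝ) * ftRe h q ^ (1 / 2 : ℝ) = ftRe h q := by
          rw [← Real.rpow_add h1]; norm_num
        have h5 : ‖q‖ ^ (γ - a) * (‖q‖ ^ (-γ) * ‖q‖ ^ a) = 1 := by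
          rw [← Real.rpow_add hpos, ← Real.rpow_add hpos]
          simp
        calc ftRe h q * ‖ft g q‖ = (ftRe h q ^ (1 / 2 : ℝ) * ftRe h q ^ (1 / 2 : ℝ)) *
              (‖q‖ ^ (γ - a) * (‖q‖ ^ (-γ) * ‖q‖ ^ a)) * ‖ft g q‖ := by rw [h4, h5, mul_one]
          _ = _ := by ring
      -- Peetre's inequality: decay in `q - p` and in `q` together give decay in `p`.
      have h6 : ((1 + ‖q - p‖) ^ M)⁻¹ * ((1 + ‖q‖) ^ M)⁻¹ ≤ ((1 + ‖p‖) ^ M)⁻¹ := by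
        rw [← mul_inv, ← mul_pow]
        have h7 : ‖p‖ ≤ ‖q - p‖ + ‖q‖ := by
          have := norm_sub_le q (q - p)
          rw [sub_sub_cancel] at this
          linarith
        have h8 : 1 + ‖p‖ ≤ (1 + ‖q - p‖) * (1 + ‖q‖) := by
          nlinarith [mul_nonneg (norm_nonneg (q - p)) (norm_nonneg q)]
        gcongr
      simp only [h3]
      calc C * ((1 + ‖q - p‖) ^ M)⁻¹ *
            (ftRe h q ^ (1 / 2 : ℝ) * ‖q‖ ^ (γ - a) * ‖(φ : Space s → ℂ) q‖)
          ≤ C * ((1 + ‖q - p‖) ^ M)⁻¹ *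
            (D ^ (1 / 2 : ℝ) * (((1 + ‖q‖) ^ M)⁻¹ * A q) * ‖(φ : Space s → ℂ) q‖) :=
            mul_le_mul_of_nonneg_left
              (mul_le_mul_of_nonneg_right (hW q) (norm_nonneg _)) (by positivity)
        _ = C * D ^ (1 / 2 : ℝ) * (((1 + ‖q - p‖) ^ M)⁻¹ * ((1 + ‖q‖) ^ M)⁻¹) *
            (A q * ‖(φ : Space s → ℂ) q‖) := by ring
        _ ≤ C * D ^ (1 / 2 : ℝ) * ((1 + ‖p‖) ^ M)⁻¹ * (A q * ‖(φ : Space s → ℂ) q‖) := by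
            have := hA0 q
            gcongr
    _ = C * D ^ (1 / 2 : ℝ) * ((1 + ‖p‖) ^ M)⁻¹ * ∫ q, A q * ‖(φ : Space s → ℂ) q‖ :=
      integral_const_mul _ _
    _ ≤ C * D ^ (1 / 2 : ℝ) * ((1 + ‖p‖) ^ M)⁻¹ * (N * ‖φ‖) := by
      gcongr
      exact integral_mul_norm_le hA2 hA0 φ
    _ = C * D ^ (1 / 2 : ℝ) * N * ‖φ‖ * ((1 + ‖p‖) ^ M)⁻¹ := by ring

end MasslessField
-- Contour shift in one variable
namespace MasslessField

/-- Cauchy's theorem for a horizontal strip below the real axis. -/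
theorem integral_eq_integral_sub_mul_I {f : ℂ → ℂ} {η D : ℝ} (hη : 0 ≤ η)
    (hd : ∀ w : ℂ, -η ≤ w.im → w.im ≤ 0 → DifferentiableAt ℂ f w)
    (hb : ∀ w : ℂ, -η ≤ w.im → w.im ≤ 0 → ‖f w‖ ≤ D * (1 + w.re ^ 2)⁻¹) :
    ∫ y : ℝ, f y = ∫ y : ℝ, f (y - η * Complex.I) := by
  have him : ∀ y t : ℝ, ((y : ℂ) + t * Complex.I).im = t := fun y t => by simp
  have hre : ∀ y t : ℝ, ((y : ℂ) + t * Complex.I).re = y := fun y t => by simp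
  have hint : ∀ t : ℝ, -η ≤ t → t ≤ 0 → Integrable fun y : ℝ => f (y + t * Complex.I) := by
    intro t h1 h2
    refine (integrable_inv_one_add_sq.const_mul D).mono' (Continuous.aestronglyMeasurable ?_)
      (Filter.Eventually.of_forall fun y => ?_)
    · refine continuous_iff_continuousAt.2 fun y => ?_
      exact ContinuousAt.comp (f := fun y : ℝ => (y : ℂ) + t * Complex.I)
        (hd _ (by rwa [him]) (by rwa [him])).continuousAt (by fun_prop)
    · simpa [hre] using hb (y + t * Complex.I) (by rwa [him]) (by rwa [him])
  -- The rectangle has opposite corners `-T` and `T - iη`. The difference of the horizontal sides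
  -- equals that of the vertical ones, which tend to zero as `T → ∞`.
  have hrect : ∀ T : ℝ, (∫ y in (-T)..T, f (y + (0 : ℝ) * Complex.I)) -
      (∫ y in (-T)..T, f (y + (-η : ℝ) * Complex.I)) =
      Complex.I • (∫ t in (0 : ℝ)..(-η), f ((-T : ℝ) + t * Complex.I)) -
        Complex.I • (∫ t in (0 : ℝ)..(-η), f ((T : ℝ) + t * Complex.I)) := by
    intro T
    have := Complex.integral_boundary_rect_eq_zero_of_differentiableOn f
      (((-T : ℝ) : ℂ) + (0 : ℝ) * Complex.I) ((T : ℂ) + (-η : ℝ) * Complex.I) ?_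
    · rw [him, him, hre, hre] at this
      linear_combination this
    · intro w hw
      rw [him, him, hre, hre, Set.uIcc_of_ge (by linarith : -η ≤ 0)] at hw
      exact (hd w hw.2.1 hw.2.2).differentiableWithinAt
  have hvert : ∀ T : ℝ, ‖Complex.I • ∫ t in (0 : ℝ)..(-η), f ((T : ℝ) + t * Complex.I)‖ ≤
      D * (1 + T ^ 2)⁻¹ * η := by
    intro T
    rw [norm_smul, Complex.norm_I, one_mul]
    have := intervalIntegral.norm_integral_le_of_norm_le_const (a := 0) (b := -η)
      (f := fun t : ℝ => f ((T : ℝ) + t * Complex.I)) (C := D * (1 + T ^ 2)⁻¹) ?_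
    · simpa [abs_of_nonneg hη] using this
    · intro t ht
      rw [Set.uIoc_of_ge (by linarith)] at ht
      simpa [hre] using hb (T + t * Complex.I) (by rw [him]; exact ht.1.le) (by rw [him]; exact ht.2)
  have hlim : Tendsto (fun T : ℝ => D * (1 + T ^ 2)⁻¹ * η + D * (1 + T ^ 2)⁻¹ * η) atTop (𝓝 0) := by
    have h1 : Tendsto (fun T : ℝ => (1 + T ^ 2)⁻¹) atTop (𝓝 0) :=
      tendsto_inv_atTop_zero.comp (tendsto_atTop_add_const_left _ _ (tendsto_pow_atTop two_ne_zero))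
    have h2 := ((h1.const_mul D).mul_const η).add ((h1.const_mul D).mul_const η)
    simpa using h2
  have hzero : Tendsto (fun T : ℝ => (∫ y in (-T)..T, f (y + (0 : ℝ) * Complex.I)) -
      (∫ y in (-T)..T, f (y + (-η : ℝ) * Complex.I))) atTop (𝓝 0) := by
    refine squeeze_zero_norm (fun T => ?_) hlim
    rw [hrect]
    refine (norm_sub_le _ _).trans (add_le_add ?_ (hvert T))
    simpa using hvert (-T)
  have hmain := ((intervalIntegral_tendsto_integral (hint 0 (by linarith) le_rfl)
    tendsto_neg_atTop_atBot tendsto_id).sub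
    (intervalIntegral_tendsto_integral (hint (-η) le_rfl (by linarith))
      tendsto_neg_atTop_atBot tendsto_id))
  have := tendsto_nhds_unique hmain hzero
  rw [sub_eq_zero] at this
  simpa [sub_eq_add_neg] using this

/-- Imaginary parts give `Re S · Im S = Re w · Im w`. If `|Im S|` exceeded `|Im w|`, the real parts
would force `|Re S| > |Re w|`, and the two products would differ. This is the source of `|x| -
|x⁰|`: a contour shift by `η` enlarges the time factor by at most `e^{|x⁰|η}`. -/
theorem abs_im_le_of_sq_eq {S w : ℂ} {ρ : ℝ} (h : S ^ 2 = w ^ 2 + (ρ : ℂ) ^ 2) :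
    |S.im| ≤ |w.im| := by
  have h1 := congrArg Complex.re h
  have h2 := congrArg Complex.im h
  simp only [sq, Complex.mul_re, Complex.mul_im, Complex.add_re, Complex.add_im, Complex.ofReal_re,
    Complex.ofReal_im] at h1 h2
  by_contra hlt
  have h3 : w.im ^ 2 < S.im ^ 2 := sq_lt_sq.2 (not_le.1 hlt)
  have h4 : S.re * S.im = w.re * w.im := by linarith
  have h5 : S.re ^ 2 * S.im ^ 2 = w.re ^ 2 * w.im ^ 2 := by
    rw [← mul_pow, ← mul_pow, h4]
  have h6 : w.re ^ 2 < S.re ^ 2 := by nlinarith [mul_self_nonneg ρ]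
  have h7 : w.re ^ 2 * w.im ^ 2 ≤ w.re ^ 2 * S.im ^ 2 := by gcongr
  have h8 : w.re ^ 2 * S.im ^ 2 < S.re ^ 2 * S.im ^ 2 := by
    have : 0 < S.im ^ 2 := (sq_nonneg _).trans_lt h3
    gcongr
  linarith

theorem integrable_inv_sq_add_sq {ρ : ℝ} (hρ : 0 < ρ) :
    Integrable (fun y : ℝ => (y ^ 2 + ρ ^ 2)⁻¹) ∧ ∫ y : ℝ, (y ^ 2 + ρ ^ 2)⁻¹ = Real.pi / ρ := by
  have h : (fun y : ℝ => (y ^ 2 + ρ ^ 2)⁻¹) = fun y => (ρ ^ 2)⁻¹ * (1 + (y / ρ) ^ 2)⁻¹ := by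
    ext y
    field_simp
    ring
  rw [h]
  refine ⟨(integrable_inv_one_add_sq.comp_div hρ.ne').const_mul _, ?_⟩
  rw [integral_const_mul, Measure.integral_comp_div (fun y : ℝ => (1 + y ^ 2)⁻¹),
    integral_univ_inv_one_add_sq, abs_of_pos hρ, smul_eq_mul]
  field_simp

/-- Decay of an oscillatory integral with phase `x₀ √(y² + ρ²) - ν y`, by a shift of the contour. -/
theorem norm_integral_line_le {U V : ℂ → ℂ} (hU : Differentiable ℂ U) (hV : Differentiable ℂ V)
    {B : ℝ} (hB : 0 ≤ B) (hUb : ∀ w : ℂ, |w.im| ≤ 1 → ‖U w‖ ≤ B * (1 + |w.re|)⁻¹)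
    (hVb : ∀ w : ℂ, |w.im| ≤ 1 → ‖V w‖ ≤ B * (1 + |w.re|)⁻¹) {k : ℕ} (hk : k ≤ 1)
    {ρ η ν x₀ : ℝ} (hρ : 0 < ρ) (hη0 : 0 ≤ η) (hηρ : η ≤ ρ / 2) (hη1 : η ≤ 1) (hx : |x₀| ≤ ν) :
    ‖∫ y : ℝ, U y * V y * ((((y ^ 2 + ρ ^ 2)⁻¹ ^ k : ℝ)) : ℂ) *
        Complex.exp (Complex.I * ((√(y ^ 2 + ρ ^ 2) * x₀ - ν * y : ℝ) : ℂ))‖ ≤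
      B ^ 2 * Real.exp (-((ν - |x₀|) * η)) * (Real.pi * (1 + 2 / ρ)) := by
  -- The principal square root: its square is right everywhere, but holomorphy is available only off
  -- the branch cut.
  set S : ℂ → ℂ := fun w => (w ^ 2 + (ρ : ℂ) ^ 2) ^ ((2 : ℕ) : ℂ)⁻¹ with hS
  have hSsq : ∀ w, S w ^ 2 = w ^ 2 + (ρ : ℂ) ^ 2 := fun w => Complex.cpow_nat_inv_pow _ two_ne_zero
  set f : ℂ → ℂ := fun w => U w * V w * ((w ^ 2 + (ρ : ℂ) ^ 2)⁻¹) ^ k *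
    Complex.exp (Complex.I * (S w * x₀ - ν * w)) with hf
  have hfreal : ∀ y : ℝ, U y * V y * ((((y ^ 2 + ρ ^ 2)⁻¹ ^ k : ℝ)) : ℂ) *
        Complex.exp (Complex.I * ((√(y ^ 2 + ρ ^ 2) * x₀ - ν * y : ℝ) : ℂ)) = f y := by
    intro y
    have h1 : S y = ((√(y ^ 2 + ρ ^ 2) : ℝ) : ℂ) := by
      rw [Real.sqrt_eq_rpow, Complex.ofReal_cpow (by positivity)]
      simp [hS]
    simp only [hf, h1]
    push_cast
    rfl
  -- The condition `η ≤ ρ / 2` keeps `w² + ρ²` in the right half-plane, away from the cut and from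
  -- zero. The same bound controls its inverse, needed for `k = 1`.
  have hre : ∀ w : ℂ, -η ≤ w.im → w.im ≤ 0 →
      (w.re ^ 2 + ρ ^ 2) / 2 ≤ (w ^ 2 + (ρ : ℂ) ^ 2).re := by
    intro w h1 h2
    simp only [sq, Complex.mul_re, Complex.add_re, Complex.ofReal_re, Complex.ofReal_im]
    nlinarith [mul_self_nonneg w.re, mul_self_nonneg (w.im + η), mul_self_nonneg (ρ / 2 - η)]
  have hpos : ∀ w : ℂ, -η ≤ w.im → w.im ≤ 0 → 0 < (w ^ 2 + (ρ : ℂ) ^ 2).re := fun w h1 h2 =>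
    lt_of_lt_of_le (by positivity) (hre w h1 h2)
  have hne : ∀ w : ℂ, -η ≤ w.im → w.im ≤ 0 → w ^ 2 + (ρ : ℂ) ^ 2 ≠ 0 := fun w h1 h2 h3 => by
    have := hpos w h1 h2
    rw [h3] at this
    exact lt_irrefl _ this
  have hd : ∀ w : ℂ, -η ≤ w.im → w.im ≤ 0 → DifferentiableAt ℂ f w := by
    intro w h1 h2
    have hq : DifferentiableAt ℂ (fun w : ℂ => w ^ 2 + (ρ : ℂ) ^ 2) w := by fun_prop
    have hSd : DifferentiableAt ℂ S w :=
      hq.cpow (differentiableAt_const _) (Or.inl (hpos w h1 h2))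
    have hE : DifferentiableAt ℂ (fun w => Complex.exp (Complex.I * (S w * x₀ - ν * w))) w :=
      (((hSd.mul_const _).sub (differentiableAt_id.const_mul _)).const_mul _).cexp
    exact (((hU w).mul (hV w)).mul ((hq.inv (hne w h1 h2)).pow k)).mul hE
  have hexp : ∀ w : ℂ, w.im ≤ 0 →
      ‖Complex.exp (Complex.I * (S w * x₀ - ν * w))‖ ≤ Real.exp ((ν - |x₀|) * w.im) := by
    intro w h2
    rw [Complex.norm_exp, Real.exp_le_exp]
    have h3 : (Complex.I * (S w * x₀ - ν * w)).re = ν * w.im - (S w).im * x₀ := by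
      simp
    have h4 := abs_im_le_of_sq_eq (hSsq w)
    have h5 : -((S w).im * x₀) ≤ |w.im| * |x₀| := by
      refine (neg_le_abs _).trans ?_
      rw [abs_mul]
      gcongr
    rw [abs_of_nonpos h2] at h5
    rw [h3]
    linarith
  have hbd : ∀ w : ℂ, -η ≤ w.im → w.im ≤ 0 → ‖f w‖ ≤
      B ^ 2 * Real.exp ((ν - |x₀|) * w.im) *
        ((1 + w.re ^ 2)⁻¹ * (1 + 2 * (w.re ^ 2 + ρ ^ 2)⁻¹)) := by
    intro w h1 h2
    have h3 : |w.im| ≤ 1 := abs_le.2 ⟨by linarith, by linarith⟩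
    have h4 : ‖(w ^ 2 + (ρ : ℂ) ^ 2)⁻¹‖ ≤ 2 * (w.re ^ 2 + ρ ^ 2)⁻¹ := by
      rw [norm_inv, ← div_eq_mul_inv, ← inv_div]
      exact inv_anti₀ (by positivity) ((hre w h1 h2).trans (Complex.re_le_norm _))
    have h5 : ‖((w ^ 2 + (ρ : ℂ) ^ 2)⁻¹) ^ k‖ ≤ 1 + 2 * (w.re ^ 2 + ρ ^ 2)⁻¹ := by
      have h6 : 0 ≤ 2 * (w.re ^ 2 + ρ ^ 2)⁻¹ := by positivity
      interval_cases k
      · simp only [pow_zero, norm_one]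
        linarith
      · rw [pow_one]
        linarith
    have h7 : (1 + |w.re|)⁻¹ * (1 + |w.re|)⁻¹ ≤ (1 + w.re ^ 2)⁻¹ := by
      rw [← mul_inv]
      refine inv_anti₀ (by positivity) ?_
      nlinarith [abs_nonneg w.re, sq_abs w.re]
    calc ‖f w‖ = ‖U w‖ * ‖V w‖ * ‖((w ^ 2 + (ρ : ℂ) ^ 2)⁻¹) ^ k‖ *
          ‖Complex.exp (Complex.I * (S w * x₀ - ν * w))‖ := by simp only [hf, norm_mul]
      _ ≤ (B * (1 + |w.re|)⁻¹) * (B * (1 + |w.re|)⁻¹) * (1 + 2 * (w.re ^ 2 + ρ ^ 2)⁻¹) *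
          Real.exp ((ν - |x₀|) * w.im) := by
        gcongr
        · exact hUb w h3
        · exact hVb w h3
        · exact hexp w h2
      _ = B ^ 2 * Real.exp ((ν - |x₀|) * w.im) * (((1 + |w.re|)⁻¹ * (1 + |w.re|)⁻¹) *
          (1 + 2 * (w.re ^ 2 + ρ ^ 2)⁻¹)) := by ring
      _ ≤ _ := by gcongr
  have hshift := integral_eq_integral_sub_mul_I (f := f) (η := η)
    (D := B ^ 2 * (1 + 2 * (ρ ^ 2)⁻¹)) hη0 hd (fun w h1 h2 => by
      refine (hbd w h1 h2).trans ?_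
      have h3 : Real.exp ((ν - |x₀|) * w.im) ≤ 1 :=
        Real.exp_le_one_iff.2 (mul_nonpos_of_nonneg_of_nonpos (by linarith) h2)
      have h4 : (w.re ^ 2 + ρ ^ 2)⁻¹ ≤ (ρ ^ 2)⁻¹ :=
        inv_anti₀ (by positivity) (by linarith [sq_nonneg w.re])
      calc B ^ 2 * Real.exp ((ν - |x₀|) * w.im) *
            ((1 + w.re ^ 2)⁻¹ * (1 + 2 * (w.re ^ 2 + ρ ^ 2)⁻¹))
          ≤ B ^ 2 * 1 * ((1 + w.re ^ 2)⁻¹ * (1 + 2 * (ρ ^ 2)⁻¹)) := by gcongr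
        _ = _ := by ring)
  simp only [hfreal]
  rw [hshift]
  obtain ⟨hi, hv⟩ := integrable_inv_sq_add_sq hρ
  -- This majorant serves both values of `k`; its integral produces the factor `π (1 + 2/ρ)`.
  have hsum : Integrable fun y : ℝ => B ^ 2 * Real.exp (-((ν - |x₀|) * η)) *
      ((1 + y ^ 2)⁻¹ + 2 * (y ^ 2 + ρ ^ 2)⁻¹) :=
    (integrable_inv_one_add_sq.add (hi.const_mul 2)).const_mul _
  refine (norm_integral_le_of_norm_le hsum (Filter.Eventually.of_forall fun y => ?_)).trans
    (le_of_eq ?_)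
  · have h1 : ((y : ℂ) - η * Complex.I).im = -η := by simp
    have h2 : ((y : ℂ) - η * Complex.I).re = y := by simp
    refine (hbd _ h1.ge (by rw [h1]; linarith)).trans ?_
    rw [h1, h2, mul_neg]
    have h3 : (1 + y ^ 2)⁻¹ ≤ 1 := inv_le_one_of_one_le₀ (by linarith [sq_nonneg y])
    have h4 : (1 + y ^ 2)⁻¹ * (2 * (y ^ 2 + ρ ^ 2)⁻¹) ≤ 2 * (y ^ 2 + ρ ^ 2)⁻¹ :=
      mul_le_of_le_one_left (by positivity) h3
    rw [mul_add, mul_one]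
    gcongr
  · rw [integral_const_mul, integral_add integrable_inv_one_add_sq (hi.const_mul 2),
      integral_const_mul, hv, integral_univ_inv_one_add_sq]
    ring

end MasslessField
-- Restriction of Fourier transforms to complexified lines
namespace MasslessField

variable {s : ℕ}

/-- The Fourier transform of `u` on the complexified line `q + w n`. -/
noncomputable def ftLine (u : Space s → ℂ) (n q : Space s) (w : ℂ) : ℂ :=
  (((2 * Real.pi) ^ (-(s : ℝ) / 2) : ℝ) : ℂ) *
    ∫ x, Complex.exp (w * (-Complex.I * ((inner ℝ n x : ℝ) : ℂ))) *
      (Complex.exp (-Complex.I * ((inner ℝ q x : ℝ) : ℂ)) * u x)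

/-- The imaginary part of `w` becomes the real exponential weight `e^{Im w ⟨n,x⟩}`. For `‖n‖ = 1`,
bounds uniform in `‖v‖ ≤ 1` thus become bounds in the strip `|Im w| ≤ 1`. -/
theorem ftLine_eq (u : Space s → ℂ) (n q : Space s) (w : ℂ) :
    ftLine u n q w =
      ft (fun x => ((Real.exp (inner ℝ (w.im • n) x) : ℝ) : ℂ) * u x) (q + w.re • n) := by
  unfold ftLine ft
  congr 2
  ext x
  simp only [← mul_assoc, ← Complex.exp_add, Complex.ofReal_exp]
  congr 2
  rw [inner_add_left, inner_smul_left, inner_smul_left]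
  conv_lhs => rw [← Complex.re_add_im w]
  simp only [conj_trivial]
  push_cast
  linear_combination (-((w.im : ℂ) * (inner ℝ n x : ℝ))) * Complex.I_sq

theorem IsTest.differentiable_ftLine {R : ℝ} {u : Space s → ℂ} (hu : IsTest R u)
    (n q : Space s) : Differentiable ℂ (ftLine u n q) := by
  intro w₀
  set v : Space s → ℂ := fun x => Complex.exp (-Complex.I * ((inner ℝ q x : ℝ) : ℂ)) * u x with hv
  have hvc : Continuous v := by
    have := hu.1.continuous
    fun_prop
  have hvs : HasCompactSupport v := hu.hasCompactSupport.mul_left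
  have hF : ∀ w : ℂ, Continuous fun x =>
      Complex.exp (w * (-Complex.I * ((inner ℝ n x : ℝ) : ℂ))) * v x := fun w => by fun_prop
  have hF' : Continuous fun x =>
      Complex.exp (w₀ * (-Complex.I * ((inner ℝ n x : ℝ) : ℂ))) *
        (-Complex.I * ((inner ℝ n x : ℝ) : ℂ)) * v x := by fun_prop
  have hbc : Continuous fun x => Real.exp ((‖w₀‖ + 1) * |inner ℝ n x|) * |inner ℝ n x| * ‖v x‖ := by
    fun_prop
  have key := hasDerivAt_integral_of_dominated_loc_of_deriv_le (μ := (volume : Measure (Space s)))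
    (F := fun (w : ℂ) x => Complex.exp (w * (-Complex.I * ((inner ℝ n x : ℝ) : ℂ))) * v x)
    (F' := fun (w : ℂ) x => Complex.exp (w * (-Complex.I * ((inner ℝ n x : ℝ) : ℂ))) *
      (-Complex.I * ((inner ℝ n x : ℝ) : ℂ)) * v x)
    (bound := fun x => Real.exp ((‖w₀‖ + 1) * |inner ℝ n x|) * |inner ℝ n x| * ‖v x‖)
    (ball_mem_nhds w₀ one_pos)
    (Filter.Eventually.of_forall fun w => (hF w).aestronglyMeasurable)
    ((hF w₀).integrable_of_hasCompactSupport hvs.mul_left)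
    hF'.aestronglyMeasurable
    (Filter.Eventually.of_forall fun x w hw => ?_)
    (hbc.integrable_of_hasCompactSupport hvs.norm.mul_left)
    (Filter.Eventually.of_forall fun x w _ => ?_)
  · exact (key.2.const_mul _).differentiableAt
  · have h1 : ‖w‖ ≤ ‖w₀‖ + 1 := by
      have := norm_le_norm_add_norm_sub' w w₀
      rw [mem_ball_iff_norm] at hw
      linarith
    have h2 : ‖-Complex.I * ((inner ℝ n x : ℝ) : ℂ)‖ = |inner ℝ n x| := by simp
    rw [norm_mul, norm_mul, h2]
    gcongr
    refine (Complex.norm_exp_le_exp_norm _).trans (Real.exp_le_exp.2 ?_)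
    rw [norm_mul, h2]
    gcongr
  · exact ((((hasDerivAt_id w).mul_const _).cexp).mul_const _).congr_deriv (by simp)

/-- Cartesian coordinates with respect to a given direction. -/
theorem exists_line_decomposition (m : ℕ) {n : Space (m + 1)} (hn : ‖n‖ = 1) :
    ∃ (ι : Space m → Space (m + 1)) (e : (ℝ × Space m) ≃ᵐ Space (m + 1)),
      MeasurePreserving e ∧ (∀ y z, e (y, z) = ι z + y • n) ∧ (∀ z, inner ℝ (ι z) n = 0) ∧
      ∀ y z, ‖ι z + y • n‖ = √(y ^ 2 + ‖z‖ ^ 2) := by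
  -- An orthonormal basis with `b 0 = n`; its coordinates preserve volume, and the remaining vectors
  -- span the transverse space.
  obtain ⟨b, hb⟩ := Orthonormal.exists_orthonormalBasis_extension_of_card_eq (𝕜 := ℝ)
    (E := Space (m + 1)) (ι := Fin (m + 1)) (by simp) (v := fun _ => n) (s := {0}) (by
      rw [orthonormal_iff_ite]
      rintro ⟨i, rfl⟩ ⟨j, rfl⟩
      simp [Set.domRestrict, hn])
  have hb0 : b 0 = n := hb 0 rfl
  let e : (ℝ × Space m) ≃ᵐ Space (m + 1) :=
    ((MeasurableEquiv.prodCongr (MeasurableEquiv.refl ℝ)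
      (MeasurableEquiv.toLp 2 (Fin m → ℝ)).symm).trans
      (MeasurableEquiv.piFinSuccAbove (fun _ => ℝ) 0).symm).trans
      ((MeasurableEquiv.toLp 2 (Fin (m + 1) → ℝ)).trans b.measurableEquiv.symm)
  have he : ∀ y z, e (y, z) = b.repr.symm (WithLp.toLp 2 (Fin.cons y z.ofLp)) := by
    intro y z
    change b.repr.symm (WithLp.toLp 2 (Fin.insertNth 0 y z.ofLp)) = _
    rw [Fin.insertNth_zero']
  have hsum : ∀ y z, e (y, z) = y • n + ∑ i : Fin m, z i • b i.succ := by
    intro y z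
    rw [he, ← b.sum_repr_symm, Fin.sum_univ_succ]
    simp [hb0]
  refine ⟨fun z => ∑ i : Fin m, z i • b i.succ, e, ?_, fun y z => ?_, fun z => ?_, fun y z => ?_⟩
  · refine MeasurePreserving.trans (MeasurePreserving.trans (μb := volume) ?_ ?_)
      (MeasurePreserving.trans (PiLp.volume_preserving_toLp _) b.measurePreserving_repr_symm)
    · exact (MeasurePreserving.id _).prod (PiLp.volume_preserving_ofLp _)
    · exact (volume_preserving_piFinSuccAbove (fun _ => ℝ) 0).symm
  · exact (hsum y z).trans (add_comm _ _)
  · rw [sum_inner]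
    refine Finset.sum_eq_zero fun i _ => ?_
    rw [inner_smul_left, ← hb0, b.inner_eq_zero (Fin.succ_ne_zero i), mul_zero]
  · have h1 : (∑ i : Fin m, z i • b i.succ) + y • n = e (y, z) :=
      (add_comm _ _).trans (hsum y z).symm
    simp only [h1]
    rw [he, LinearIsometryEquiv.norm_map, EuclideanSpace.norm_eq,
      EuclideanSpace.norm_sq_eq, Fin.sum_univ_succ]
    simp

end MasslessField
-- Integration over the transverse momenta
namespace MasslessField

/-- With `η = ρ / (2(1 + ρ)) ≤ 1`, one has `(1 + d) η ≤ 1 + dη`, and any power of `1 + dη` is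
dominated by `e^{dη}`. The power decay in `d` is paid for by a singularity `ρ^{-κ}`. -/
theorem exists_exp_neg_mul_le {κ : ℝ} (hκ : 0 ≤ κ) :
    ∃ C : ℝ, 0 ≤ C ∧ ∀ d ρ : ℝ, 0 ≤ d → 0 < ρ →
      Real.exp (-(d * (ρ / (2 * (1 + ρ))))) ≤
        C * (1 + d) ^ (-κ) * ((1 + ρ) ^ κ * ρ ^ (-κ)) := by
  set N : ℕ := ⌈κ⌉₊ with hN
  refine ⟨N.factorial * Real.exp 1 * 2 ^ κ, by positivity, fun d ρ hd hρ => ?_⟩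
  set η : ℝ := ρ / (2 * (1 + ρ)) with hη
  have hη0 : 0 < η := by positivity
  have hη1 : η ≤ 1 := by rw [hη, div_le_one (by positivity)]; linarith
  have h1 : ((1 + d) * η) ^ κ ≤ N.factorial * Real.exp 1 * Real.exp (d * η) := calc
    ((1 + d) * η) ^ κ ≤ (1 + d * η) ^ κ := by gcongr; linarith
    _ ≤ (1 + d * η) ^ (N : ℝ) :=
      Real.rpow_le_rpow_of_exponent_le (by nlinarith) (Nat.le_ceil κ)
    _ = (1 + d * η) ^ N := Real.rpow_natCast _ _
    _ ≤ N.factorial * Real.exp (1 + d * η) := by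
      have := Real.pow_div_factorial_le_exp (x := 1 + d * η) (by positivity) N
      rwa [div_le_iff₀' (by positivity)] at this
    _ = N.factorial * Real.exp 1 * Real.exp (d * η) := by rw [Real.exp_add]; ring
  have h2 : (1 + ρ) ^ κ * ρ ^ (-κ) = 2 ^ (-κ) * η ^ (-κ) := by
    rw [hη, Real.div_rpow hρ.le (by positivity), Real.mul_rpow (by norm_num) (by positivity),
      Real.rpow_neg (by positivity : 0 ≤ 1 + ρ), Real.rpow_neg (by norm_num : (0 : ℝ) ≤ 2)]
    have : (2 : ℝ) ^ κ ≠ 0 := by positivity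
    field_simp
  have h3 : (2 : ℝ) ^ κ * 2 ^ (-κ) = 1 := by
    rw [← Real.rpow_add (by norm_num), add_neg_cancel, Real.rpow_zero]
  rw [h2, Real.exp_neg]
  have h4 : N.factorial * Real.exp 1 * 2 ^ κ * (1 + d) ^ (-κ) * (2 ^ (-κ) * η ^ (-κ)) =
      N.factorial * Real.exp 1 * (((1 + d) * η) ^ κ)⁻¹ := by
    rw [← Real.rpow_neg (by positivity), Real.mul_rpow (by positivity) hη0.le]
    linear_combination (N.factorial * Real.exp 1 * (1 + d) ^ (-κ) * η ^ (-κ)) * h3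
  rw [h4, ← div_eq_mul_inv, inv_le_comm₀ (Real.exp_pos _) (by positivity), inv_div,
    div_le_iff₀ (by positivity)]
  linarith

theorem integrable_inv_pow_mul_rpow {m : ℕ} (hm : 1 ≤ m) {α : ℝ} (hα0 : 0 ≤ α) (hα : α < m) :
    Integrable fun z : Space m => ((1 + ‖z‖) ^ (m + 1))⁻¹ * ‖z‖ ^ (-α) := by
  have h1 : Integrable fun z : Space m => ((1 + ‖z‖) ^ (m + 1))⁻¹ := by
    have := integrable_one_add_norm (E := Space m) (μ := volume) (r := ((m + 1 : ℕ) : ℝ))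
      (by rw [finrank_euclideanSpace_fin]; exact_mod_cast Nat.lt_succ_self m)
    refine this.congr (Filter.Eventually.of_forall fun q => ?_)
    simp only
    rw [Real.rpow_neg (by positivity), Real.rpow_natCast]
  have h2 : IntegrableOn (fun z : Space m => ‖z‖ ^ (-α)) (ball 0 1) := by
    refine integrableOn_ball_of_norm_le_rpow (C := 1) (α := α)
      (by rw [finrank_euclideanSpace_fin]; omega) (by rwa [finrank_euclideanSpace_fin]) ?_ ?_
    · filter_upwards with q
      rw [Real.norm_of_nonneg (by positivity), one_mul]
    · exact (measurable_norm.pow_const _).aestronglyMeasurable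
  rw [← integrable_indicator_iff measurableSet_ball] at h2
  refine (h2.add h1).mono' ?_ (Filter.Eventually.of_forall fun z => ?_)
  · exact (h1.aestronglyMeasurable.mul (measurable_norm.pow_const _).aestronglyMeasurable)
  · rw [Real.norm_of_nonneg (by positivity), Pi.add_apply]
    have h3 : ((1 + ‖z‖) ^ (m + 1))⁻¹ ≤ 1 := inv_le_one_of_one_le₀ (one_le_pow₀ (by simp))
    by_cases hz : z ∈ ball (0 : Space m) 1
    · rw [Set.indicator_of_mem hz]
      have h4 : ((1 + ‖z‖) ^ (m + 1))⁻¹ * ‖z‖ ^ (-α) ≤ ‖z‖ ^ (-α) :=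
        mul_le_of_le_one_left (by positivity) h3
      have : 0 ≤ ((1 + ‖z‖) ^ (m + 1))⁻¹ := by positivity
      linarith
    · rw [Set.indicator_of_notMem hz, zero_add]
      refine mul_le_of_le_one_right (by positivity) ?_
      exact Real.rpow_le_one_of_one_le_of_nonpos (by simpa using hz) (by linarith)

/-- The integrand of the two-point function `⟨V f, U(x) V f⟩`, where `f = ω^{1/2 - k} g̃` and
`u = h * g`. -/
noncomputable def twoPoint {s : ℕ} (u : Space s → ℂ) (k : ℕ) (x₀ : ℝ) (x p : Space s) : ℂ :=
  ft u p * conj (ft u p) * ((((‖p‖ ^ 2)⁻¹ ^ k : ℝ)) : ℂ) * phase x₀ x p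

/-- Of the `L + 1` powers of decay, `L` go to the transverse momentum `ρ` and one to the line
variable, as the contour shift requires. The shift `ρ / (2(1 + ρ))` is at most both `ρ / 2`, which
avoids the branch points, and `1`, the height at which the bound on `u` ends. -/
theorem norm_integral_twoPoint_line_le {m : ℕ} {R : ℝ} {u : Space (m + 1) → ℂ}
    (hu : IsTest R u) {B : ℝ} (hB : 0 ≤ B) {L : ℕ}
    (hb : ∀ v : Space (m + 1), ‖v‖ ≤ 1 → ∀ p,
      ‖ft (fun x => ((Real.exp (inner ℝ v x) : ℝ) : ℂ) * u x) p‖ ≤ B * ((1 + ‖p‖) ^ (L + 1))⁻¹)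
    {k : ℕ} (hk : k ≤ 1) {n : Space (m + 1)} (hn : ‖n‖ = 1) {ν x₀ : ℝ} (hx : |x₀| ≤ ν)
    {q : Space (m + 1)} (hq : inner ℝ q n = 0) {ρ : ℝ} (hρ : 0 < ρ)
    (hqn : ∀ y : ℝ, ‖q + y • n‖ = √(y ^ 2 + ρ ^ 2)) :
    ‖∫ y : ℝ, twoPoint u k x₀ (ν • n) (q + y • n)‖ ≤
      (B * ((1 + ρ) ^ L)⁻¹) ^ 2 * Real.exp (-((ν - |x₀|) * (ρ / (2 * (1 + ρ))))) *
        (Real.pi * (1 + 2 / ρ)) := by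
  set U : ℂ → ℂ := ftLine u n q with hU
  have hUb : ∀ w : ℂ, |w.im| ≤ 1 → ‖U w‖ ≤ B * ((1 + ρ) ^ L)⁻¹ * (1 + |w.re|)⁻¹ := by
    intro w hw
    rw [hU, ftLine_eq]
    refine (hb _ (by rw [norm_smul, hn, mul_one, Real.norm_eq_abs]; exact hw) _).trans ?_
    rw [mul_assoc, ← mul_inv, pow_succ, hqn]
    have h1 : ρ ≤ √(w.re ^ 2 + ρ ^ 2) := Real.le_sqrt_of_sq_le (by linarith [sq_nonneg w.re])
    have h2 : |w.re| ≤ √(w.re ^ 2 + ρ ^ 2) := Real.abs_le_sqrt (by linarith [sq_nonneg ρ])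
    gcongr
  have hUreal : ∀ y : ℝ, U y = ft u (q + y • n) := by
    intro y
    rw [hU, ftLine_eq]
    simp
  have hUd : Differentiable ℂ U := hu.differentiable_ftLine n q
  -- Schwarz reflection supplies the entire extension of `conj (ft u)` from the real line.
  have hVd : Differentiable ℂ (conj ∘ U ∘ conj) := fun w => by
    have := (hUd (conj w)).conj_conj
    rwa [Complex.conj_conj] at this
  have key := norm_integral_line_le hUd hVd (B := B * ((1 + ρ) ^ L)⁻¹) (by positivity) hUb
    (fun w hw => by
      have := hUb (conj w) (by simpa using hw)
      simpa using this) hk hρ (η := ρ / (2 * (1 + ρ))) (by positivity)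
    (by rw [div_le_div_iff₀ (by positivity) (by norm_num)]; nlinarith)
    (by rw [div_le_one (by positivity)]; linarith) hx
  refine le_trans (le_of_eq (congrArg _ (integral_congr_ae ?_))) key
  filter_upwards with y
  have h1 : inner ℝ (q + y • n) (ν • n) = ν * y := by
    rw [inner_add_left, inner_smul_right, hq, inner_smul_left, inner_smul_right,
      real_inner_self_eq_norm_sq, hn]
    simp
    ring
  simp only [twoPoint, phase, h1, hqn, Real.sq_sqrt (by positivity : 0 ≤ y ^ 2 + ρ ^ 2),
    Function.comp_apply, Complex.conj_ofReal, hUreal]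

/-- Fubini along the direction of `x` and the line bound leave a singularity `‖z‖^{-(κ+1)}` in `m`
transverse dimensions: `κ` powers from the exponential and one from the factor `1 + 2/ρ`. Hence the
threshold `κ + 1 < m`. -/
theorem exists_norm_integral_twoPoint_le {m : ℕ} (hm : 1 ≤ m) {κ : ℝ} (hκ0 : 0 ≤ κ)
    (hκ : κ + 1 < m) : ∃ C : ℝ, 0 ≤ C ∧ ∀ (R : ℝ) (u : Space (m + 1) → ℂ), IsTest R u →
      ∀ B : ℝ, 0 ≤ B → (∀ v : Space (m + 1), ‖v‖ ≤ 1 → ∀ p,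
        ‖ft (fun x => ((Real.exp (inner ℝ v x) : ℝ) : ℂ) * u x) p‖ ≤
          B * ((1 + ‖p‖) ^ (m + 2))⁻¹) →
      ∀ k : ℕ, k ≤ 1 → ∀ (x₀ : ℝ) (x : Space (m + 1)), |x₀| ≤ ‖x‖ →
        Integrable (twoPoint u k x₀ x) →
        ‖∫ p, twoPoint u k x₀ x p‖ ≤ C * B ^ 2 * (1 + (‖x‖ - |x₀|)) ^ (-κ) := by
  obtain ⟨C, hC0, hC⟩ := exists_exp_neg_mul_le hκ0
  have hΘ := integrable_inv_pow_mul_rpow hm (by linarith : 0 ≤ κ + 1) hκ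
  set Θ : Space m → ℝ := fun z => ((1 + ‖z‖) ^ (m + 1))⁻¹ * ‖z‖ ^ (-(κ + 1)) with hΘd
  refine ⟨C * (2 * Real.pi) * ∫ z, Θ z, mul_nonneg (by positivity)
    (integral_nonneg fun z => by positivity), ?_⟩
  intro R u hu B hB hb k hk x₀ x hx hint
  -- At `x = 0` any unit vector serves.
  obtain ⟨n, hn, hxn⟩ : ∃ n : Space (m + 1), ‖n‖ = 1 ∧ x = ‖x‖ • n := by
    rcases eq_or_ne x 0 with rfl | h0
    · exact ⟨EuclideanSpace.single 0 1, by simp, by simp⟩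
    · exact ⟨‖x‖⁻¹ • x, norm_smul_inv_norm h0, by
        rw [smul_smul, mul_inv_cancel₀ (norm_ne_zero_iff.2 h0), one_smul]⟩
  obtain ⟨ι, e, hmp, he, hι, hnorm⟩ := exists_line_decomposition m hn
  set d : ℝ := ‖x‖ - |x₀| with hd
  have hd0 : 0 ≤ d := by linarith
  have hfub : ∫ p, twoPoint u k x₀ x p =
      ∫ z, ∫ y : ℝ, twoPoint u k x₀ (‖x‖ • n) (ι z + y • n) := by
    rw [← hmp.integral_comp' (twoPoint u k x₀ x), Measure.volume_eq_prod, integral_prod_symm]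
    · simp only [he, ← hxn]
    · exact (hmp.integrable_comp_emb e.measurableEmbedding).2 hint
  rw [hfub]
  refine (norm_integral_le_of_norm_le
    (hΘ.const_mul (C * (2 * Real.pi) * B ^ 2 * (1 + d) ^ (-κ))) ?_).trans (le_of_eq ?_)
  · filter_upwards [ae_ne_zero hm] with z hz
    have hρ : 0 < ‖z‖ := norm_pos_iff.2 hz
    refine (norm_integral_twoPoint_line_le hu hB hb hk hn hx (hι z) hρ
      (fun y => hnorm y z)).trans ?_
    have h1 : 1 + 2 / ‖z‖ ≤ 2 * ((1 + ‖z‖) * ‖z‖⁻¹) := by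
      rw [div_eq_mul_inv, add_mul, mul_inv_cancel₀ hρ.ne']
      linarith
    have h2 := hC d ‖z‖ hd0 hρ
    have h3 : (1 + ‖z‖) ^ κ ≤ (1 + ‖z‖) ^ m := by
      rw [← Real.rpow_natCast]
      exact Real.rpow_le_rpow_of_exponent_le (by linarith) (by linarith)
    have h4 : ‖z‖ ^ (-κ) * ‖z‖⁻¹ = ‖z‖ ^ (-(κ + 1)) := by
      rw [← Real.rpow_neg_one, ← Real.rpow_add hρ]
      congr 1
      ring
    -- One of the two factors `(1 + ‖z‖)^{-(m+1)}` absorbs the growth `(1 + ‖z‖)^m (1 + ‖z‖)`; the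
    -- other makes `Θ` integrable at infinity.
    calc (B * ((1 + ‖z‖) ^ (m + 1))⁻¹) ^ 2 * Real.exp (-(d * (‖z‖ / (2 * (1 + ‖z‖))))) *
          (Real.pi * (1 + 2 / ‖z‖))
        ≤ (B * ((1 + ‖z‖) ^ (m + 1))⁻¹) ^ 2 *
          (C * (1 + d) ^ (-κ) * ((1 + ‖z‖) ^ m * ‖z‖ ^ (-κ))) *
          (Real.pi * (2 * ((1 + ‖z‖) * ‖z‖⁻¹))) := by
          gcongr
          refine h2.trans ?_
          gcongr
      _ = C * (2 * Real.pi) * B ^ 2 * (1 + d) ^ (-κ) *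
          (((1 + ‖z‖) ^ (m + 1))⁻¹ * (‖z‖ ^ (-κ) * ‖z‖⁻¹)) *
          (((1 + ‖z‖) ^ (m + 1))⁻¹ * (1 + ‖z‖) ^ (m + 1)) := by ring
      _ = C * (2 * Real.pi) * B ^ 2 * (1 + d) ^ (-κ) * Θ z := by
          rw [inv_mul_cancel₀ (by positivity), mul_one, h4]
  · rw [integral_const_mul]
    ring

end MasslessField
-- From the core to the operators `T` and `T_{h,±}`
namespace MasslessField

variable {s : ℕ}

theorem norm_posSqrt_apply_sq {H : Type*} [NormedAddCommGroup H] [InnerProductSpace ℂ H]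
    [CompleteSpace H] {A : H →L[ℂ] H} (hA : 0 ≤ A) (e : H) :
    ‖posSqrt A e‖ ^ 2 = (inner ℂ e (A e)).re := by
  have h1 : star (posSqrt A) = posSqrt A := (CFC.sqrt_nonneg A).isSelfAdjoint
  have h2 : A e = posSqrt A (posSqrt A e) :=
    (DFunLike.congr_fun (CFC.sqrt_mul_sqrt_self A hA) e).symm
  have h3 : inner ℂ (posSqrt A e) (posSqrt A e) = inner ℂ e (A e) := by
    rw [← ContinuousLinearMap.adjoint_inner_right, ← ContinuousLinearMap.star_eq_adjoint, h1, h2]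
  rw [← h3, inner_self_eq_norm_sq_to_K]
  norm_cast

theorem inner_absSq_apply (X : OneParticle s →L[ℂ] OneParticle s) (e : OneParticle s) :
    (inner ℂ e (absSq X e)).re = ‖X e‖ ^ 2 := by
  rw [absSq, mul_apply_eq_comp, ContinuousLinearMap.star_eq_adjoint,
    ContinuousLinearMap.adjoint_inner_right, inner_self_eq_norm_sq_to_K]
  norm_cast

/-- Since `T` is self-adjoint, `‖Te‖² = ⟨e, T² e⟩`, and `T²` is the sum of the `A* A`. In particular
each `‖T_{h,±} e‖` is at most `‖Te‖`. -/
theorem norm_opT_apply_sq (r : ℝ) (h : Space s → ℝ) (E γ : ℝ) (e : OneParticle s) :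
    ‖opT s r h E γ e‖ ^ 2 = ‖opE E (LPlus s r) e‖ ^ 2 + ‖opE E (LMinus s r) e‖ ^ 2 +
      ‖opH h γ (LPlus s r) e‖ ^ 2 + ‖opH h γ (LMinus s r) e‖ ^ 2 := by
  have hpos : ∀ X : OneParticle s →L[ℂ] OneParticle s, 0 ≤ absSq X := fun X => star_mul_self_nonneg X
  rw [opT, norm_posSqrt_apply_sq
    (add_nonneg (add_nonneg (add_nonneg (hpos _) (hpos _)) (hpos _)) (hpos _))]
  simp only [add_apply, inner_add_right, Complex.add_re, inner_absSq_apply]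

section Local

variable {r : ℝ} {h : Space s → ℝ}

theorem opV_starProjection (hs : 3 ≤ s) (h_smooth : ContDiff ℝ ∞ h)
    (h_supp : tsupport h ⊆ ball 0 r) {a : ℝ} (ha : |a| ≤ 1 / 2) (e : OneParticle s) :
    opV h (localSubspace s r a) ((localSubspace s r a).starProjection e) =
      opV h (localSubspace s r a) e := by
  have h1 : (localSubspace s r a).starProjection ((localSubspace s r a).starProjection e) =
      (localSubspace s r a).starProjection e :=
    Submodule.starProjection_eq_self_iff.2 (Submodule.starProjection_apply_mem _ e)
  apply Lp.ext
  filter_upwards [opV_apply hs h_smooth h_supp ha e,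
    opV_apply hs h_smooth h_supp ha ((localSubspace s r a).starProjection e)] with p hp1 hp2
  rw [hp1, hp2, h1]

theorem opH_starProjection (hs : 3 ≤ s) (h_smooth : ContDiff ℝ ∞ h)
    (h_supp : tsupport h ⊆ ball 0 r) {γ : ℝ} (hγ0 : 0 ≤ γ) (hγ : γ < ((s : ℝ) - 1) / 2)
    {a : ℝ} (ha : |a| ≤ 1 / 2) (e : OneParticle s) :
    opH h γ (localSubspace s r a) ((localSubspace s r a).starProjection e) =
      opH h γ (localSubspace s r a) e := by
  have h1 : (localSubspace s r a).starProjection ((localSubspace s r a).starProjection e) =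
      (localSubspace s r a).starProjection e :=
    Submodule.starProjection_eq_self_iff.2 (Submodule.starProjection_apply_mem _ e)
  apply Lp.ext
  filter_upwards [opH_apply hs h_smooth h_supp hγ0 hγ ha e,
    opH_apply hs h_smooth h_supp hγ0 hγ ha ((localSubspace s r a).starProjection e)] with p hp1 hp2
  rw [hp1, hp2, h1]

/-- Integrand of the two-point function of an element of the core. -/
theorem inner_opV_transl_eq (hs : 3 ≤ s) (h_smooth : ContDiff ℝ ∞ h)
    (h_supp : tsupport h ⊆ ball 0 r)
    (h_pos : ∀ p, ∃ y : ℝ, 0 < y ∧ ft (fun x => (h x : ℂ)) p = (y : ℂ))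
    {a : ℝ} (ha : |a| ≤ 1 / 2) {k : ℕ} (hak : a = 1 / 2 - k) {f : OneParticle s}
    (hfK : f ∈ localSubspace s r a) {g u : Space s → ℂ}
    (hf : (f : Space s → ℂ) =ᵐ[volume] fun p => ((‖p‖ ^ a : ℝ) : ℂ) * ft g p)
    (hug : ∀ p, ft u p = ft (fun x => (h x : ℂ)) p * ft g p) (x₀ : ℝ) (x : Space s) :
    Integrable (twoPoint u k x₀ x) ∧
      inner ℂ (opV h (localSubspace s r a) f) (transl x₀ x (opV h (localSubspace s r a) f)) =
        ∫ p, twoPoint u k x₀ x p := by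
  set F := opV h (localSubspace s r a) f with hF
  have hae : (fun p => inner ℂ ((F : Space s → ℂ) p) ((transl x₀ x F : Space s → ℂ) p))
      =ᵐ[volume] twoPoint u k x₀ x := by
    filter_upwards [opV_apply hs h_smooth h_supp ha f, hf, (memLp_phase x₀ x F).coeFn_toLp,
      ae_ne_zero (by omega : 1 ≤ s)] with p h1 h2 h3 hp
    have hpos : 0 < ‖p‖ := norm_pos_iff.2 hp
    rw [Submodule.starProjection_eq_self_iff.2 hfK, h2] at h1
    have h4 : (transl x₀ x F : Space s → ℂ) p = phase x₀ x p * (F : Space s → ℂ) p := h3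
    have h5 : ‖p‖ ^ (-(1 / 2) : ℝ) * ‖p‖ ^ a = (‖p‖⁻¹) ^ k := by
      rw [← Real.rpow_add hpos, hak, inv_pow, ← Real.rpow_natCast, ← Real.rpow_neg hpos.le]
      congr 1
      ring
    have h6 : (F : Space s → ℂ) p = (((‖p‖⁻¹) ^ k : ℝ) : ℂ) * ft u p := by
      rw [hF, h1, hug, (ft_eq_ftRe h_pos p).2, ← h5]
      push_cast
      ring
    rw [h4, h6, RCLike.inner_apply, twoPoint, map_mul, Complex.conj_ofReal, inv_pow (‖p‖ ^ 2),
      ← pow_mul, mul_comm 2 k, pow_mul, ← inv_pow, ← inv_pow]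
    push_cast
    ring
  -- Integrability, needed for Fubini, comes from the pairing of two `L²` vectors, also for the
  -- singular weight with `k = 1`.
  exact ⟨(L2.integrable_inner F (transl x₀ x F)).congr hae, by
    rw [L2.inner_def, integral_congr_ae hae]⟩

/-- On the core this combines the strip bound, with `B` a multiple of `‖T_{h,±} f‖`, and the decay
of the two-point integral. Both sides are continuous in the vector, so the inequality extends to the
closure, and both operators depend only on the projection of `e`. -/
theorem exists_norm_inner_opV_le (hs : 3 ≤ s) (h_smooth : ContDiff ℝ ∞ h)
    (h_supp : tsupport h ⊆ ball 0 r)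
    (h_pos : ∀ p, ∃ y : ℝ, 0 < y ∧ ft (fun x => (h x : ℂ)) p = (y : ℂ))
    {κ : ℝ} (hκ0 : 0 ≤ κ) (hκ : κ < (s : ℝ) - 2)
    {a : ℝ} (ha : |a| ≤ 1 / 2) {k : ℕ} (hk : k ≤ 1) (hak : a = 1 / 2 - k) :
    ∃ C : ℝ, 0 ≤ C ∧ ∀ γ : ℝ, 1 / 2 ≤ γ → γ < ((s : ℝ) - 1) / 2 → ∀ (e : OneParticle s)
      (x₀ : ℝ) (x : Space s), |x₀| ≤ ‖x‖ →
        ‖inner ℂ (opV h (localSubspace s r a) e)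
          (transl x₀ x (opV h (localSubspace s r a) e))‖ ≤
          C * ‖opH h γ (localSubspace s r a) e‖ ^ 2 * (1 + (‖x‖ - |x₀|)) ^ (-κ) := by
  obtain ⟨m, rfl⟩ : ∃ m, s = m + 1 := ⟨s - 1, by omega⟩
  push_cast at hκ
  obtain ⟨C₁, hC₁, h₁⟩ := exists_norm_ft_exp_mul_le_norm (by omega) h_smooth h_supp h_pos (m + 2)
  obtain ⟨C₂, hC₂, h₂⟩ := exists_norm_integral_twoPoint_le (m := m) (by omega) hκ0 (by linarith)
  refine ⟨C₂ * C₁ ^ 2, by positivity, fun γ hγ1 hγ2 e x₀ x hx => ?_⟩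
  set K := localSubspace (m + 1) r a
  have hcore : ∀ f ∈ localCore (s := m + 1) r a,
      ‖inner ℂ (opV h K f) (transl x₀ x (opV h K f))‖ ≤
        C₂ * C₁ ^ 2 * ‖opH h γ K f‖ ^ 2 * (1 + (‖x‖ - |x₀|)) ^ (-κ) := by
    intro f hfc
    have hfK : f ∈ K := Submodule.le_topologicalClosure _ hfc
    obtain ⟨g, hg, hf⟩ := hfc
    obtain ⟨u, hu, hug⟩ := (isTest_ofReal h_smooth h_supp).exists_ft_eq_mul hg
    obtain ⟨hint, heq⟩ := inner_opV_transl_eq hs h_smooth h_supp h_pos ha hak hfK hf hug x₀ x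
    have hφ : (opH h γ K f : Space (m + 1) → ℂ) =ᵐ[volume] fun p =>
        ((‖p‖ ^ (-γ) * ftRe h p ^ (1 / 2 : ℝ) : ℝ) : ℂ) * (((‖p‖ ^ a : ℝ) : ℂ) * ft g p) := by
      filter_upwards [opH_apply hs h_smooth h_supp (by linarith : 0 ≤ γ) hγ2 ha f, hf] with p hp hq
      rw [hp, Submodule.starProjection_eq_self_iff.2 hfK, hq]
    rw [heq]
    refine (h₂ _ u hu (C₁ * ‖opH h γ K f‖) (by positivity)
      (fun v hv p => h₁ γ a hγ1 hγ2 ha g u _ hu hug hφ v hv p) k hk x₀ x hx hint).trans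
      (le_of_eq (by ring))
  have hclosed : IsClosed {f : OneParticle (m + 1) |
      ‖inner ℂ (opV h K f) (transl x₀ x (opV h K f))‖ ≤
        C₂ * C₁ ^ 2 * ‖opH h γ K f‖ ^ 2 * (1 + (‖x‖ - |x₀|)) ^ (-κ)} := by
    have hV : Continuous fun f => opV h K f := (opV h K).continuous
    have hH : Continuous fun f => opH h γ K f := (opH h γ K).continuous
    have hT : Continuous fun f => transl x₀ x (opV h K f) := (transl x₀ x).continuous.comp hV
    exact isClosed_le (hV.inner hT).norm
      ((continuous_const.mul (hH.norm.pow 2)).mul continuous_const)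
  have hmem : ‖inner ℂ (opV h K (K.starProjection e))
      (transl x₀ x (opV h K (K.starProjection e)))‖ ≤
      C₂ * C₁ ^ 2 * ‖opH h γ K (K.starProjection e)‖ ^ 2 * (1 + (‖x‖ - |x₀|)) ^ (-κ) :=
    closure_minimal (fun f hf => hcore f hf) hclosed
      (show K.starProjection e ∈ closure (localCore (s := m + 1) r a : Set (OneParticle (m + 1)))
        from Submodule.starProjection_apply_mem K e)
  have hVe : opV h K (K.starProjection e) = opV h K e :=
    opV_starProjection hs h_smooth h_supp ha e
  have hHe : opH h γ K (K.starProjection e) = opH h γ K e :=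
    opH_starProjection hs h_smooth h_supp (by linarith) hγ2 ha e
  rwa [hVe, hHe] at hmem

end Local

end MasslessField

/-! ### The decay estimate for eigenvectors of `T` -/

theorem mainTheorem4 (s : ℕ) (hs : 3 ≤ s) (r : ℝ) (hr : 0 < r)
    (h : MasslessField.Space s → ℝ) (h_smooth : ContDiff ℝ ∞ h) (h_supp : tsupport h ⊆ ball 0 r)
    (h_pos : ∀ p, ∃ y : ℝ, 0 < y ∧ MasslessField.ft (fun x => (h x : ℂ)) p = (y : ℂ))
    (ε : ℝ) (hε : 0 < ε) :
    ∃ c : ℝ, ∀ E γ : ℝ, 0 ≤ E → 1 / 2 ≤ γ → γ < ((s : ℝ) - 1) / 2 →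
      ∀ (e : MasslessField.OneParticle s) (t : ℝ), ‖e‖ ≤ 1 →
        MasslessField.opT s r h E γ e = (t : ℂ) • e → MasslessField.opJ e = e →
        ∀ (x₀ : ℝ) (x : MasslessField.Space s), |x₀| ≤ ‖x‖ →
          ‖inner ℂ (MasslessField.opV h (MasslessField.LPlus s r) e)
              (MasslessField.transl x₀ x (MasslessField.opV h (MasslessField.LPlus s r) e))‖
            ≤ c * t ^ 2 / (‖x‖ - |x₀| + 1) ^ ((s : ℝ) - 2 - ε) ∧
          ‖inner ℂ (MasslessField.opV h (MasslessField.LMinus s r) e)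
              (MasslessField.transl x₀ x (MasslessField.opV h (MasslessField.LMinus s r) e))‖
            ≤ c * t ^ 2 / (‖x‖ - |x₀| + 1) ^ ((s : ℝ) - 2 - ε) := by
  have hs' : (3 : ℝ) ≤ s := by exact_mod_cast hs
  -- Truncating `ε` at one keeps `κ ≥ 0`, as `s ≥ 3`. The required exponent `s - 2 - ε` is at most
  -- `κ`, and the base `‖x‖ - |x₀| + 1` is at least one.
  set κ : ℝ := (s : ℝ) - 2 - min ε 1 with hκ
  have hκ0 : 0 ≤ κ := by linarith [min_le_right ε 1]
  have hκ1 : κ < (s : ℝ) - 2 := by linarith [lt_min hε one_pos]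
  have hκε : (s : ℝ) - 2 - ε ≤ κ := by linarith [min_le_left ε 1]
  obtain ⟨C₁, hC₁, h₁⟩ := MasslessField.exists_norm_inner_opV_le hs h_smooth h_supp h_pos hκ0 hκ1
    (a := -(1 / 2)) (by norm_num) (k := 1) le_rfl (by norm_num)
  obtain ⟨C₂, hC₂, h₂⟩ := MasslessField.exists_norm_inner_opV_le hs h_smooth h_supp h_pos hκ0 hκ1
    (a := 1 / 2) (by norm_num) (k := 0) zero_le_one (by norm_num)
  refine ⟨max C₁ C₂, fun E γ _ hγ1 hγ2 e t he hT _ x₀ x hx => ?_⟩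
  have hsum := MasslessField.norm_opT_apply_sq r h E γ e
  have hTe : ‖MasslessField.opT s r h E γ e‖ ^ 2 ≤ t ^ 2 := by
    rw [hT, norm_smul, mul_pow, Complex.norm_real, Real.norm_eq_abs, sq_abs]
    exact mul_le_of_le_one_right (sq_nonneg t) (pow_le_one₀ (norm_nonneg e) he)
  have hd : 1 ≤ ‖x‖ - |x₀| + 1 := by linarith
  have hfinal : ∀ C τ I : ℝ, 0 ≤ C → C ≤ max C₁ C₂ → τ ^ 2 ≤ t ^ 2 →
      I ≤ C * τ ^ 2 * (1 + (‖x‖ - |x₀|)) ^ (-κ) →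
      I ≤ max C₁ C₂ * t ^ 2 / (‖x‖ - |x₀| + 1) ^ ((s : ℝ) - 2 - ε) := by
    intro C τ I hC hCm hτ hI
    have h3 : (1 + (‖x‖ - |x₀|)) ^ (-κ) ≤ ((‖x‖ - |x₀| + 1) ^ ((s : ℝ) - 2 - ε))⁻¹ := by
      rw [← Real.rpow_neg (by linarith), add_comm 1]
      exact Real.rpow_le_rpow_of_exponent_le hd (by linarith)
    rw [div_eq_mul_inv]
    refine hI.trans ?_
    have : 0 ≤ (1 + (‖x‖ - |x₀|)) ^ (-κ) := Real.rpow_nonneg (by linarith) _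
    gcongr
  have hE1 := sq_nonneg ‖MasslessField.opE E (MasslessField.LPlus s r) e‖
  have hE2 := sq_nonneg ‖MasslessField.opE E (MasslessField.LMinus s r) e‖
  have hH1 := sq_nonneg ‖MasslessField.opH h γ (MasslessField.LPlus s r) e‖
  have hH2 := sq_nonneg ‖MasslessField.opH h γ (MasslessField.LMinus s r) e‖
  exact ⟨hfinal _ _ _ hC₁ (le_max_left _ _) (by linarith) (h₁ γ hγ1 hγ2 e x₀ x hx),
    hfinal _ _ _ hC₂ (le_max_right _ _) (by linarith) (h₂ γ hγ1 hγ2 e x₀ x hx)⟩
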